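/- Write points of the closed half-space $\overline{\mathbb{R}^3_+}=\mathbb{R}^2\times[0,\infty)$ as $x=(x_2,x_3,y)$, and put $\rho=\sqrt{x_2^2+x_3^2+y^2}$, $\hat\rho=\sqrt{\rho^2+1}$. Let $\beta>0$ and let $f$ be a real-valued function, smooth on $\mathbb{R}^2\times[0,\infty)$ (up to the boundary), with $f=O(\rho^{-(4+2\beta)})$ uniformly as $\rho\to\infty$. For $t\in[0,1]$ consider the Dirichlet problem $$\Delta u-tu=f\ \text{ on } \mathbb{R}^2\times(0,\infty),\qquad u|_{y=0}=0 .$$ (i) For $t=0$ the problem has a solution $u$, smooth on $\mathbb{R}^2\times[0,\infty)$, which vanishes linearly and uniformly at the boundary, i.e. there are $C,\delta>0$ with $|u(x)|\le Cy$ whenever $0\le y\le\delta$, and which decays quadratically and uniformly at infinity, i.e. $u=O(\rho^{-2})$ uniformly as $\rho\to\infty$. (ii) For every $t\in(0,1]$ the problem has a solution $u$, smooth on $\mathbb{R}^2\times[0,\infty)$, which vanishes linearly and uniformly at the boundary in the same sense, and for which there is a constant $C_{f,t}$ (depending on $f$, its decay exponent $\beta$, and $t$, but not on $\beta'$) such that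 $$|u|\le C_{f,t}\,\hat\rho^{-(2+2\beta')}\quad\text{on }\mathbb{R}^2\times[0,\infty),\ \text{ for all } \beta'<\beta .$$ -/

import Mathlib

open scoped ContDiff

noncomputable section

namespace HalfSpace

/-- Euclidean three-space with coordinates `(x₂, x₃, y) = (x 0, x 1, x 2)`. -/
abbrev E3 : Type := EuclideanSpace ℝ (Fin 3)

/-- The closed half-space `ℝ² × [0, ∞)`. -/
def closedHalf : Set E3 := {x | 0 ≤ x 2}

/-- The open half-space `ℝ² × (0, ∞)`. -/
def openHalf : Set E3 := {x | 0 < x 2}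

/-- `ρ = √(x₂² + x₃² + y²)`. -/
def rho (x : E3) : ℝ := ‖x‖

/-- `ρ̂ = √(ρ² + 1)`. -/
def rhoHat (x : E3) : ℝ := Real.sqrt (rho x ^ 2 + 1)

/-- `g = O(ρ ^ (-s))` as `ρ → ∞`, uniformly over the closed half-space. -/
def DecaysAtInfinity (g : E3 → ℝ) (s : ℝ) : Prop :=
  ∃ C R : ℝ, 0 < R ∧ ∀ x ∈ closedHalf, R ≤ rho x → |g x| ≤ C * rho x ^ (-s)

/-- `u = O(y)` as `y → 0`, uniformly in `(x₂, x₃)`. -/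
def VanishesLinearly (u : E3 → ℝ) : Prop :=
  ∃ C δ : ℝ, 0 < δ ∧ ∀ x ∈ closedHalf, x 2 ≤ δ → |u x| ≤ C * x 2

/-- `u` is a solution, smooth up to the boundary, of `Δ u - t u = f` on the half-space with
`u = 0` on the boundary `y = 0`. Only the values of `u` and `f` on the closed half-space matter. -/
structure IsSmoothDirichletSolution (t : ℝ) (f u : E3 → ℝ) : Prop where
  smooth : ContDiffOn ℝ ∞ u closedHalf
  equation : ∀ x ∈ openHalf, Laplacian.laplacian u x - t * u x = f x
  boundary : ∀ x : E3, x 2 = 0 → u x = 0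

end HalfSpace

end

/-! The solution is an explicit potential. With `k = √t`, let `ker k z = -e^{-k‖z‖}/(4π‖z‖)` be the
decaying fundamental solution of `Δ - k²` and put `u = conv (ker k) (oddExt f)`. The kernel is
radial and the density is odd under reflection in `y = 0`, so `u` is odd and vanishes on the
boundary. Since `u` is also Lipschitz (`exists_lipschitz_conv_ker`), it vanishes linearly there.

Inside the half-space, `interior_regularity` gives smoothness and the equation; it rests on the
distributional identity `integral_ker_mul`. Smoothness up to the boundary is the delicate point,
because `oddExt f` jumps across `y = 0`. After a cutoff, tangential derivatives of the potential are
potentials of tangential derivatives of the data, and the equation expresses the second normal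
derivative through quantities already controlled. An induction on the order then closes
(`HalfTest.contDiffOn_conv`).

For decay at `t = 0`, oddness replaces the kernel by half the difference of its values at `x - z`
and `refl x - z`, which is of size `‖z‖/‖x‖²` when `z` is small compared with `x`; when `z` is
large, the decay of `f` supplies the factor `‖x‖⁻²` (`exists_quadratic_decay`). For `t > 0` the
exponential factor lets the potential inherit the full rate `4 + 2β` of `f`, which exceeds what is
asked (`exists_screened_decay`). -/

noncomputable section

namespace HalfSpace

open MeasureTheory Set Filter Topology Metric

/-! ### Coordinates and partial derivatives -/

/-- The `i`-th standard basis vector. -/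
def e (i : Fin 3) : E3 := EuclideanSpace.single i 1

/-- The `i`-th partial derivative. -/
def pd (i : Fin 3) (f : E3 → ℝ) (x : E3) : ℝ := fderiv ℝ f x (e i)

lemma e_apply (i j : Fin 3) : e i j = if j = i then 1 else 0 := by
  simp [e]

lemma norm_e (i : Fin 3) : ‖e i‖ = 1 := by simp [e]

lemma inner_e (x : E3) (i : Fin 3) : inner ℝ x (e i) = x i := by
  rw [e, EuclideanSpace.inner_single_right]
  simp

lemma sum_smul_e (x : E3) : ∑ i, x i • e i = x := by
  ext j
  fin_cases j <;> simp [Fin.sum_univ_three, e_apply]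

lemma norm_sq_eq (x : E3) : ‖x‖ ^ 2 = x 0 ^ 2 + x 1 ^ 2 + x 2 ^ 2 := by
  rw [EuclideanSpace.real_norm_sq_eq, Fin.sum_univ_three]

lemma fderiv_apply_eq_sum (f : E3 → ℝ) (x y : E3) :
    fderiv ℝ f x y = ∑ i, y i * pd i f x := by
  conv_lhs => rw [← sum_smul_e y]
  simp [pd]

lemma laplacian_eq_sum_pd {f : E3 → ℝ} {x : E3} (hf : ContDiffAt ℝ 2 f x) :
    Laplacian.laplacian f x = ∑ i, pd i (pd i f) x := by
  have h := congrFun (InnerProductSpace.laplacian_eq_iteratedFDeriv_orthonormalBasis f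
    (EuclideanSpace.basisFun (Fin 3) ℝ)) x
  rw [h]
  refine Finset.sum_congr rfl fun i _ => ?_
  rw [iteratedFDeriv_two_apply]
  have hd : DifferentiableAt ℝ (fderiv ℝ f) x :=
    (hf.fderiv_right (m := 1) (by norm_num)).differentiableAt (by norm_num)
  simp only [EuclideanSpace.basisFun_apply, Matrix.cons_val_zero, Matrix.cons_val_one]
  change _ = fderiv ℝ (fun z => fderiv ℝ f z (e i)) x (e i)
  rw [fderiv_clm_apply hd (differentiableAt_const _)]
  simp [e]

lemma contDiff_pd {f : E3 → ℝ} (hf : ContDiff ℝ ∞ f) (i : Fin 3) : ContDiff ℝ ∞ (pd i f) :=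
  (hf.fderiv_right (m := ∞) (by simp)).clm_apply contDiff_const

lemma contDiffAt_pd {f : E3 → ℝ} {x : E3} (hf : ContDiffAt ℝ ∞ f x) (i : Fin 3) :
    ContDiffAt ℝ ∞ (pd i f) x :=
  (hf.fderiv_right (m := ∞) (by simp)).clm_apply contDiffAt_const

lemma hasCompactSupport_pd {f : E3 → ℝ} (hf : HasCompactSupport f) (i : Fin 3) :
    HasCompactSupport (pd i f) :=
  hf.fderiv_apply ℝ (e i)

lemma pd_congr {f g : E3 → ℝ} {x : E3} (h : f =ᶠ[𝓝 x] g) (i : Fin 3) :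
    pd i f =ᶠ[𝓝 x] pd i g :=
  (h.fderiv (𝕜 := ℝ)).mono fun z hz => by simp only [pd, hz]

/-! ### Radial profile of the screened Newtonian kernel -/

/-- `e^{-k√w}/√w`. -/
def prof (k w : ℝ) : ℝ := Real.exp (-k * √w) / √w

/-- The derivative of `prof k`. -/
def prof₁ (k w : ℝ) : ℝ := -(Real.exp (-k * √w) * (1 + k * √w)) / (2 * √w ^ 3)

/-- The second derivative of `prof k`. -/
def prof₂ (k w : ℝ) : ℝ := Real.exp (-k * √w) * (3 + 3 * k * √w + k ^ 2 * √w ^ 2) / (4 * √w ^ 5)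

lemma hasDerivAt_prof (k : ℝ) {w : ℝ} (hw : 0 < w) : HasDerivAt (prof k) (prof₁ k w) w := by
  have hs : 0 < √w := Real.sqrt_pos.2 hw
  have h := Real.hasDerivAt_sqrt hw.ne'
  have h1 := ((h.const_mul (-k)).exp).div h hs.ne'
  refine h1.congr_deriv ?_
  unfold prof₁
  field_simp
  ring

lemma hasDerivAt_prof₁ (k : ℝ) {w : ℝ} (hw : 0 < w) : HasDerivAt (prof₁ k) (prof₂ k w) w := by
  have hs : 0 < √w := Real.sqrt_pos.2 hw
  have h := Real.hasDerivAt_sqrt hw.ne'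
  have h1 := ((((h.const_mul (-k)).exp).mul ((h.const_mul k).const_add 1)).neg).div
    ((h.pow 3).const_mul 2) (by simp only [Pi.pow_apply]; positivity)
  refine h1.congr_deriv ?_
  unfold prof₂
  simp only [Pi.mul_apply, Pi.neg_apply, Pi.pow_apply]
  field_simp
  ring

lemma prof_ode (k : ℝ) {w : ℝ} (hw : 0 < w) :
    4 * w * prof₂ k w + 6 * prof₁ k w = k ^ 2 * prof k w := by
  have hs : 0 < √w := Real.sqrt_pos.2 hw
  have h2 : w = √w ^ 2 := (Real.sq_sqrt hw.le).symm
  unfold prof prof₁ prof₂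
  generalize √w = s at *
  subst h2
  field_simp
  ring

lemma hasFDerivAt_norm_sq_add (c : ℝ) (x : E3) :
    HasFDerivAt (fun z : E3 => ‖z‖ ^ 2 + c) (2 • innerSL ℝ x) x :=
  (hasStrictFDerivAt_norm_sq x).hasFDerivAt.add_const c

lemma pd_prof (k : ℝ) {c : ℝ} {x : E3} (hx : 0 < ‖x‖ ^ 2 + c) (i : Fin 3) :
    pd i (fun z : E3 => prof k (‖z‖ ^ 2 + c)) x = 2 * x i * prof₁ k (‖x‖ ^ 2 + c) := by
  have h := (hasDerivAt_prof k hx).comp_hasFDerivAt x (hasFDerivAt_norm_sq_add c x)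
  unfold pd
  change fderiv ℝ (prof k ∘ fun z : E3 => ‖z‖ ^ 2 + c) x (e i) = _
  rw [h.fderiv]
  simp [inner_e]
  ring

lemma eventually_pos_norm_sq_add {c : ℝ} {x : E3} (hx : 0 < ‖x‖ ^ 2 + c) :
    ∀ᶠ z : E3 in 𝓝 x, 0 < ‖z‖ ^ 2 + c :=
  (by fun_prop : Continuous fun z : E3 => ‖z‖ ^ 2 + c).continuousAt.eventually
    (lt_mem_nhds hx)

lemma pd_pd_prof (k : ℝ) {c : ℝ} {x : E3} (hx : 0 < ‖x‖ ^ 2 + c) (i : Fin 3) :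
    pd i (pd i (fun z : E3 => prof k (‖z‖ ^ 2 + c))) x =
      2 * prof₁ k (‖x‖ ^ 2 + c) + 4 * x i ^ 2 * prof₂ k (‖x‖ ^ 2 + c) := by
  have h0 : pd i (fun z : E3 => prof k (‖z‖ ^ 2 + c)) =ᶠ[𝓝 x]
      fun z => 2 * z i * prof₁ k (‖z‖ ^ 2 + c) :=
    (eventually_pos_norm_sq_add hx).mono fun z hz => pd_prof k hz i
  have h1 := (hasDerivAt_prof₁ k hx).comp_hasFDerivAt x (hasFDerivAt_norm_sq_add c x)
  have h2 : HasFDerivAt (fun z : E3 => z i) (EuclideanSpace.proj (𝕜 := ℝ) i) x :=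
    (EuclideanSpace.proj (𝕜 := ℝ) i : E3 →L[ℝ] ℝ).hasFDerivAt
  have h3 := (h2.const_mul 2).mul h1
  unfold pd at h0 ⊢
  rw [h0.fderiv_eq]
  change fderiv ℝ ((fun z : E3 => 2 * z i) * (prof₁ k ∘ fun z : E3 => ‖z‖ ^ 2 + c)) x (e i) = _
  rw [h3.fderiv]
  simp [inner_e, e_apply]
  ring

lemma contDiffAt_prof (k : ℝ) {c : ℝ} {x : E3} (hx : 0 < ‖x‖ ^ 2 + c) :
    ContDiffAt ℝ ∞ (fun z : E3 => prof k (‖z‖ ^ 2 + c)) x := by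
  unfold prof
  have h : ContDiffAt ℝ ∞ (fun z : E3 => √(‖z‖ ^ 2 + c)) x :=
    ((contDiff_norm_sq ℝ).add contDiff_const).contDiffAt.sqrt hx.ne'
  exact ((contDiffAt_const.mul h).exp).div h (Real.sqrt_pos.2 hx).ne'

/-- In three dimensions the Laplacian of `h(‖x‖² + c)` is `4‖x‖² h'' + 6 h'`. Writing `‖x‖² = w - c`
and using `prof_ode` leaves the defect `-4c h''`, which vanishes for `c = 0` and concentrates at the
origin as `c → 0⁺`. -/
lemma sum_pd_pd_prof (k : ℝ) {c : ℝ} {x : E3} (hx : 0 < ‖x‖ ^ 2 + c) :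
    ∑ i, pd i (pd i (fun z : E3 => prof k (‖z‖ ^ 2 + c))) x =
      k ^ 2 * prof k (‖x‖ ^ 2 + c) - 4 * c * prof₂ k (‖x‖ ^ 2 + c) := by
  simp only [pd_pd_prof k hx, Fin.sum_univ_three]
  linear_combination prof_ode k hx - 4 * prof₂ k (‖x‖ ^ 2 + c) * norm_sq_eq x

/-! ### The fundamental solution -/

/-- Normalizing constant of the kernel (its value is `4π`). -/
def normConst : ℝ := ∫ w : E3, 3 / √(‖w‖ ^ 2 + 1) ^ 5

/-- The fundamental solution of `Δ - k²`. -/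
def ker (k : ℝ) (z : E3) : ℝ := -normConst⁻¹ * (Real.exp (-k * ‖z‖) / ‖z‖)

lemma ker_eq_prof (k : ℝ) (z : E3) : ker k z = -normConst⁻¹ * prof k (‖z‖ ^ 2 + 0) := by
  simp [ker, prof]

lemma integrable_normConst : Integrable fun w : E3 => 3 / √(‖w‖ ^ 2 + 1) ^ 5 := by
  have h := (integrable_rpow_neg_one_add_norm_sq (μ := (volume : Measure E3)) (r := 5)
    (by simp; norm_num)).const_mul 3
  refine h.congr (Eventually.of_forall fun w => ?_)
  have h1 : (0 : ℝ) < 1 + ‖w‖ ^ 2 := by positivity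
  simp only
  rw [neg_div, Real.rpow_neg h1.le, Real.sqrt_eq_rpow, ← Real.rpow_mul_natCast
    (by positivity), add_comm]
  norm_num
  exact (div_eq_mul_inv _ _).symm

lemma normConst_pos : 0 < normConst := by
  unfold normConst
  rw [integral_pos_iff_support_of_nonneg (fun w => by positivity) integrable_normConst]
  have : Function.support (fun w : E3 => 3 / √(‖w‖ ^ 2 + 1) ^ 5) = univ := by
    ext w
    simp only [Function.mem_support, mem_univ, iff_true]
    positivity
  rw [this]
  exact Measure.measure_univ_pos.2 (NeZero.ne _)

lemma prof_nonneg (k w : ℝ) : 0 ≤ prof k w := by unfold prof; positivity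

lemma prof_le {k c : ℝ} (hk : 0 ≤ k) (hc : 0 ≤ c) {z : E3} (hz : z ≠ 0) :
    prof k (‖z‖ ^ 2 + c) ≤ ‖z‖⁻¹ := by
  unfold prof
  have hz' : 0 < ‖z‖ := norm_pos_iff.2 hz
  have h1 : ‖z‖ ≤ √(‖z‖ ^ 2 + c) := Real.le_sqrt_of_sq_le (by linarith)
  rw [inv_eq_one_div]
  apply div_le_div₀ zero_le_one _ hz' h1
  rw [Real.exp_le_one_iff]
  have := mul_nonneg hk (Real.sqrt_nonneg (‖z‖ ^ 2 + c))
  linarith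

lemma integral_mul_pd_pd {Ψ g : E3 → ℝ} (hΨ : ContDiff ℝ ∞ Ψ) (hg : ContDiff ℝ ∞ g)
    (hc : HasCompactSupport g) (i : Fin 3) :
    ∫ z, Ψ z * pd i (pd i g) z = ∫ z, pd i (pd i Ψ) z * g z := by
  have key : ∀ {a b : E3 → ℝ}, ContDiff ℝ ∞ a → ContDiff ℝ ∞ b → HasCompactSupport b →
      ∫ z, a z * pd i b z = -∫ z, pd i a z * b z := by
    intro a b ha hb hcb
    refine integral_mul_fderiv_eq_neg_fderiv_mul_of_integrable ?_ ?_ ?_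
      (fun x _ => ha.differentiable (by simp) x) (fun x _ => hb.differentiable (by simp) x)
    · exact ((contDiff_pd ha i).continuous.mul hb.continuous).integrable_of_hasCompactSupport
        hcb.mul_left
    · exact (ha.continuous.mul (contDiff_pd hb i).continuous).integrable_of_hasCompactSupport
        (hasCompactSupport_pd hcb i).mul_left
    · exact (ha.continuous.mul hb.continuous).integrable_of_hasCompactSupport hcb.mul_left
  rw [key hΨ (contDiff_pd hg i) (hasCompactSupport_pd hc i), key (contDiff_pd hΨ i) hg hc, neg_neg]

lemma integral_prof_mul (k : ℝ) {c : ℝ} (hc : 0 < c) {g : E3 → ℝ} (hg : ContDiff ℝ ∞ g)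
    (hcg : HasCompactSupport g) :
    ∫ z, prof k (‖z‖ ^ 2 + c) * (∑ i, pd i (pd i g) z - k ^ 2 * g z) =
      -∫ z, 4 * c * prof₂ k (‖z‖ ^ 2 + c) * g z := by
  set Ψ : E3 → ℝ := fun z => prof k (‖z‖ ^ 2 + c) with hΨd
  have hpos : ∀ z : E3, 0 < ‖z‖ ^ 2 + c := fun z => by positivity
  have hΨ : ContDiff ℝ ∞ Ψ := contDiff_iff_contDiffAt.2 fun z => contDiffAt_prof k (hpos z)
  have hi : ∀ {a b : E3 → ℝ}, ContDiff ℝ ∞ a → ContDiff ℝ ∞ b → HasCompactSupport b →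
      Integrable fun z => a z * b z := fun ha hb hcb =>
    (ha.continuous.mul hb.continuous).integrable_of_hasCompactSupport hcb.mul_left
  have h1 : ∀ i, Integrable fun z => Ψ z * pd i (pd i g) z := fun i =>
    hi hΨ (contDiff_pd (contDiff_pd hg i) i) (hasCompactSupport_pd (hasCompactSupport_pd hcg i) i)
  have h2 : ∀ i, Integrable fun z => pd i (pd i Ψ) z * g z := fun i =>
    hi (contDiff_pd (contDiff_pd hΨ i) i) hg hcg
  have h3 : Integrable fun z => k ^ 2 * (Ψ z * g z) := (hi hΨ hg hcg).const_mul _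
  calc ∫ z, Ψ z * (∑ i, pd i (pd i g) z - k ^ 2 * g z)
      = ∫ z, (∑ i, Ψ z * pd i (pd i g) z - k ^ 2 * (Ψ z * g z)) := by
        refine integral_congr_ae (Eventually.of_forall fun z => ?_)
        simp only [Fin.sum_univ_three]; ring
    _ = (∑ i, ∫ z, pd i (pd i Ψ) z * g z) - ∫ z, k ^ 2 * (Ψ z * g z) := by
        rw [integral_sub (integrable_finsetSum _ fun i _ => h1 i) h3,
          integral_finsetSum _ fun i _ => h1 i]
        simp only [integral_mul_pd_pd hΨ hg hcg]
    _ = ∫ z, (∑ i, pd i (pd i Ψ) z * g z - k ^ 2 * (Ψ z * g z)) := by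
        rw [integral_sub (integrable_finsetSum _ fun i _ => h2 i) h3,
          integral_finsetSum _ fun i _ => h2 i]
    _ = -∫ z, 4 * c * prof₂ k (‖z‖ ^ 2 + c) * g z := by
        rw [← integral_neg]
        refine integral_congr_ae (Eventually.of_forall fun z => ?_)
        simp only
        rw [← Finset.sum_mul, hΨd, sum_pd_pd_prof k (hpos z)]
        ring

/-- Substitution `z = ε w`: the Jacobian `ε³` cancels `ε² · ε⁻⁵`, so the defect becomes an
approximate identity whose limiting mass is `normConst`. -/
lemma integral_prof₂_scaled (k : ℝ) {ε : ℝ} (hε : 0 < ε) (g : E3 → ℝ) :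
    ∫ z : E3, 4 * ε ^ 2 * prof₂ k (‖z‖ ^ 2 + ε ^ 2) * g z =
      ∫ w : E3, Real.exp (-(k * ε * √(‖w‖ ^ 2 + 1))) * (3 + 3 * (k * ε * √(‖w‖ ^ 2 + 1)) +
        (k * ε * √(‖w‖ ^ 2 + 1)) ^ 2) / √(‖w‖ ^ 2 + 1) ^ 5 * g (ε • w) := by
  have h := Measure.integral_comp_smul (volume : Measure E3)
    (fun z => 4 * ε ^ 2 * prof₂ k (‖z‖ ^ 2 + ε ^ 2) * g z) ε
  have hfin : Module.finrank ℝ E3 = 3 := by simp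
  rw [hfin, abs_of_pos (by positivity), smul_eq_mul, eq_comm, inv_mul_eq_iff_eq_mul₀
    (by positivity), ← integral_const_mul] at h
  rw [h]
  refine integral_congr_ae (Eventually.of_forall fun w => ?_)
  simp only
  have h1 : √(‖ε • w‖ ^ 2 + ε ^ 2) = ε * √(‖w‖ ^ 2 + 1) := by
    rw [norm_smul, Real.norm_of_nonneg hε.le,
      show (ε * ‖w‖) ^ 2 + ε ^ 2 = ε ^ 2 * (‖w‖ ^ 2 + 1) by ring,
      Real.sqrt_mul (by positivity), Real.sqrt_sq hε.le]
  have hs : 0 < √(‖w‖ ^ 2 + 1) := Real.sqrt_pos.2 (by positivity)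
  unfold prof₂
  rw [h1, show -k * (ε * √(‖w‖ ^ 2 + 1)) = -(k * ε * √(‖w‖ ^ 2 + 1)) by ring]
  field_simp

lemma exp_neg_mul_quadratic_le {a : ℝ} (ha : 0 ≤ a) :
    Real.exp (-a) * (3 + 3 * a + a ^ 2) ≤ 3 := by
  rw [Real.exp_neg, inv_mul_le_iff₀ (Real.exp_pos a)]
  nlinarith [Real.quadratic_le_exp_of_nonneg ha, sq_nonneg a]

lemma locallyIntegrable_inv_norm : LocallyIntegrable fun z : E3 => ‖z‖⁻¹ := by
  refine locallyIntegrable_of_norm_le_rpow (C := 1) (α := 1) (by simp) (by simp) ?_ ?_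
  · refine Eventually.of_forall fun z => ?_
    simp [Real.rpow_neg_one]
  · exact (measurable_norm.inv).aestronglyMeasurable

/-- `ker k` is a fundamental solution of `Δ - k²`. -/
theorem integral_ker_mul {k : ℝ} (hk : 0 ≤ k) {g : E3 → ℝ} (hg : ContDiff ℝ ∞ g)
    (hcg : HasCompactSupport g) :
    ∫ z, ker k z * (∑ i, pd i (pd i g) z - k ^ 2 * g z) = g 0 := by
  set G : E3 → ℝ := fun z => ∑ i, pd i (pd i g) z - k ^ 2 * g z with hG
  have hGc : Continuous G := by
    have h : ∀ i, Continuous (pd i (pd i g)) := fun i =>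
      (contDiff_pd (contDiff_pd hg i) i).continuous
    have := hg.continuous
    rw [hG]
    fun_prop
  have hGs : HasCompactSupport G := by
    have h : ∀ i, HasCompactSupport (pd i (pd i g)) := fun i =>
      hasCompactSupport_pd (hasCompactSupport_pd hcg i) i
    have h3 : HasCompactSupport fun z => ∑ i, pd i (pd i g) z := by
      simp only [Fin.sum_univ_three]
      exact ((h 0).add (h 1)).add (h 2)
    exact h3.sub hcg.mul_left
  have hbound : Integrable fun z : E3 => ‖z‖⁻¹ * ‖G z‖ := by
    have := locallyIntegrable_inv_norm.integrable_smul_left_of_hasCompactSupport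
      hGc.norm hGs.norm
    refine this.congr (Eventually.of_forall fun z => ?_)
    simp [mul_comm]
  -- The regularised kernels are dominated by `‖z‖⁻¹`, so the pairing with `G` converges to the
  -- singular one.
  have lim1 : Tendsto (fun ε : ℝ => ∫ z, prof k (‖z‖ ^ 2 + ε ^ 2) * G z) (𝓝[>] 0)
      (𝓝 (∫ z, prof k (‖z‖ ^ 2 + 0) * G z)) := by
    refine tendsto_integral_filter_of_dominated_convergence (fun z => ‖z‖⁻¹ * ‖G z‖) ?_ ?_ hbound ?_
    · refine Eventually.of_forall fun ε => ?_
      refine Measurable.aestronglyMeasurable (Measurable.mul ?_ hGc.measurable)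
      unfold prof
      fun_prop
    · refine Eventually.of_forall fun ε => ?_
      filter_upwards [Measure.ae_ne volume (0 : E3)] with z hz
      rw [norm_mul, Real.norm_of_nonneg (prof_nonneg _ _)]
      gcongr
      exact prof_le hk (sq_nonneg ε) hz
    · filter_upwards [Measure.ae_ne volume (0 : E3)] with z hz
      refine Tendsto.mul_const _ ?_
      have hz' : 0 < ‖z‖ ^ 2 + 0 := by
        have := norm_pos_iff.2 hz
        positivity
      refine (hasDerivAt_prof k hz').continuousAt.tendsto.comp ?_
      have : Tendsto (fun ε : ℝ => ‖z‖ ^ 2 + ε ^ 2) (𝓝 0) (𝓝 (‖z‖ ^ 2 + 0 ^ 2)) :=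
        (by fun_prop : Continuous fun ε : ℝ => ‖z‖ ^ 2 + ε ^ 2).tendsto 0
      simpa using this.mono_left nhdsWithin_le_nhds
  obtain ⟨M, hM⟩ := hcg.exists_bound_of_continuous hg.continuous
  -- The same quantity, up to sign, computed after integrating by parts, tends to `normConst * g 0`;
  -- comparing the two limits gives the identity.
  have lim2 : Tendsto (fun ε : ℝ => ∫ z : E3, 4 * ε ^ 2 * prof₂ k (‖z‖ ^ 2 + ε ^ 2) * g z) (𝓝[>] 0)
      (𝓝 (∫ w : E3, 3 / √(‖w‖ ^ 2 + 1) ^ 5 * g 0)) := by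
    refine Tendsto.congr' (eventually_mem_nhdsWithin.mono fun ε hε =>
      (integral_prof₂_scaled k hε g).symm) ?_
    refine tendsto_integral_filter_of_dominated_convergence
      (fun w => 3 / √(‖w‖ ^ 2 + 1) ^ 5 * M) ?_ ?_ (integrable_normConst.mul_const M) ?_
    · refine Eventually.of_forall fun ε => ?_
      have := hg.continuous.measurable
      refine Measurable.aestronglyMeasurable ?_
      fun_prop
    · filter_upwards [eventually_mem_nhdsWithin] with ε hε
      refine Eventually.of_forall fun w => ?_
      have hε' : 0 < ε := hε
      have ha : 0 ≤ k * ε * √(‖w‖ ^ 2 + 1) := by positivity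
      rw [norm_mul]
      refine mul_le_mul ?_ (hM _) (norm_nonneg _) (by positivity)
      rw [Real.norm_of_nonneg (by positivity)]
      gcongr
      exact exp_neg_mul_quadratic_le ha
    · refine Eventually.of_forall fun w => ?_
      have hgc := hg.continuous
      have hc : Continuous fun ε : ℝ => Real.exp (-(k * ε * √(‖w‖ ^ 2 + 1))) *
        (3 + 3 * (k * ε * √(‖w‖ ^ 2 + 1)) +
          (k * ε * √(‖w‖ ^ 2 + 1)) ^ 2) / √(‖w‖ ^ 2 + 1) ^ 5 * g (ε • w) := by
        fun_prop
      have := (hc.tendsto 0).mono_left (nhdsWithin_le_nhds (s := Ioi 0))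
      simpa using this
  have heq : ∫ z, prof k (‖z‖ ^ 2 + 0) * G z = -∫ w : E3, 3 / √(‖w‖ ^ 2 + 1) ^ 5 * g 0 := by
    refine tendsto_nhds_unique lim1 (lim2.neg.congr' ?_)
    filter_upwards [eventually_mem_nhdsWithin] with ε hε
    rw [integral_prof_mul k (pow_pos hε 2) hg hcg]
  simp only [ker_eq_prof, mul_assoc]
  rw [integral_const_mul, heq, integral_mul_const]
  change -normConst⁻¹ * -(normConst * g 0) = g 0
  field_simp [normConst_pos.ne']

/-! ### Potentials: integrability and Lipschitz bounds -/

/-- The convolution `K * H` of a kernel `K` with a density `H`. -/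
def conv (K H : E3 → ℝ) (x : E3) : ℝ := ∫ z, K (x - z) * H z

/-- Bounded integrable densities. -/
structure Admissible (H : E3 → ℝ) : Prop where
  integrable : Integrable H
  bounded : ∃ M, ∀ z, |H z| ≤ M

lemma integrable_indicator_inv_norm_pow {s : ℕ} (hs : s < 3) :
    Integrable ((ball (0 : E3) 1).indicator fun w => ‖w‖⁻¹ ^ s) := by
  rw [integrable_indicator_iff measurableSet_ball]
  have : LocallyIntegrable fun z : E3 => ‖z‖⁻¹ ^ s := by
    refine locallyIntegrable_of_norm_le_rpow (C := 1) (α := s) (by simp) (by simpa using hs) ?_ ?_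
    · refine Eventually.of_forall fun z => ?_
      simp [Real.rpow_neg]
    · exact (measurable_norm.inv.pow_const s).aestronglyMeasurable
  exact (this.integrableOn_isCompact (isCompact_closedBall 0 1)).mono_set ball_subset_closedBall

lemma inv_norm_pow_le (s : ℕ) (w : E3) :
    ‖w‖⁻¹ ^ s ≤ (ball (0 : E3) 1).indicator (fun w => ‖w‖⁻¹ ^ s) w + 1 := by
  by_cases hw : w ∈ ball (0 : E3) 1
  · rw [indicator_of_mem hw]; linarith
  · rw [indicator_of_notMem hw, zero_add]
    have : 1 ≤ ‖w‖ := by simpa using hw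
    exact pow_le_one₀ (by positivity) (inv_le_one_of_one_le₀ this)

/-- Near the singularity the sup bound on `H` is used, away from it the integrability of `H`. The
resulting majorant has an integral independent of where the kernel is centred. -/
lemma inv_norm_pow_mul_le {s : ℕ} {H : E3 → ℝ} {M : ℝ} (hM : ∀ z, |H z| ≤ M) (w z : E3) :
    ‖w‖⁻¹ ^ s * |H z| ≤ (ball (0 : E3) 1).indicator (fun w => ‖w‖⁻¹ ^ s) w * M + |H z| := by
  have h1 := mul_le_mul_of_nonneg_right (inv_norm_pow_le s w) (abs_nonneg (H z))
  have h0 : 0 ≤ (ball (0 : E3) 1).indicator (fun w => ‖w‖⁻¹ ^ s) w :=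
    indicator_nonneg (fun _ _ => by positivity) _
  have h2 := mul_le_mul_of_nonneg_left (hM z) h0
  linarith

lemma integrable_inv_norm_pow_mul {s : ℕ} (hs : s < 3) {H : E3 → ℝ} (hH : Admissible H) (x : E3) :
    Integrable fun z => ‖x - z‖⁻¹ ^ s * |H z| := by
  obtain ⟨M, hM⟩ := hH.bounded
  refine Integrable.mono' ((((integrable_indicator_inv_norm_pow hs).comp_sub_left x).mul_const
    M).add hH.integrable.abs) ?_ (Eventually.of_forall fun z => ?_)
  · refine AEStronglyMeasurable.mul ?_ hH.integrable.abs.aestronglyMeasurable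
    exact Measurable.aestronglyMeasurable (by fun_prop)
  · rw [Real.norm_of_nonneg (by positivity)]
    exact inv_norm_pow_mul_le hM _ _

lemma exists_integral_inv_norm_pow_mul_le {s : ℕ} (hs : s < 3) {H : E3 → ℝ} (hH : Admissible H) :
    ∃ C, ∀ x, ∫ z, ‖x - z‖⁻¹ ^ s * |H z| ≤ C := by
  obtain ⟨M, hM⟩ := hH.bounded
  have hJ := integrable_indicator_inv_norm_pow hs
  refine ⟨(∫ w, (ball (0 : E3) 1).indicator (fun w => ‖w‖⁻¹ ^ s) w) * M + ∫ z, |H z|, fun x => ?_⟩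
  have h1 := integral_sub_left_eq_self (μ := (volume : Measure E3))
    (fun w => (ball (0 : E3) 1).indicator (fun w => ‖w‖⁻¹ ^ s) w) x
  rw [← h1, ← integral_mul_const, ← integral_add ((hJ.comp_sub_left x).mul_const M)
    hH.integrable.abs]
  exact integral_mono (integrable_inv_norm_pow_mul hs hH x)
    (((hJ.comp_sub_left x).mul_const M).add hH.integrable.abs)
    fun z => inv_norm_pow_mul_le hM _ _

lemma abs_ker (k : ℝ) (z : E3) : |ker k z| = normConst⁻¹ * (Real.exp (-k * ‖z‖) / ‖z‖) := by
  have := normConst_pos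
  rw [ker, abs_mul, abs_neg, abs_of_pos (by positivity), abs_of_nonneg (by positivity)]

lemma abs_ker_le {k : ℝ} (hk : 0 ≤ k) (z : E3) : |ker k z| ≤ normConst⁻¹ * ‖z‖⁻¹ := by
  have := normConst_pos
  rw [abs_ker, ← one_div ‖z‖]
  gcongr
  rw [Real.exp_le_one_iff]
  have := mul_nonneg hk (norm_nonneg z)
  linarith

lemma measurable_ker (k : ℝ) : Measurable (ker k) := by
  unfold ker
  fun_prop

lemma locallyIntegrable_ker {k : ℝ} (hk : 0 ≤ k) : LocallyIntegrable (ker k) := by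
  refine (locallyIntegrable_inv_norm.smul normConst⁻¹).mono
    (measurable_ker k).aestronglyMeasurable (Eventually.of_forall fun z => ?_)
  have := normConst_pos
  simp only [Pi.smul_apply, smul_eq_mul, norm_mul, norm_inv, norm_norm]
  rw [Real.norm_of_nonneg this.le]
  exact abs_ker_le hk z

lemma integrable_ker_mul {k : ℝ} (hk : 0 ≤ k) {H : E3 → ℝ} (hH : Admissible H) (x : E3) :
    Integrable fun z => ker k (x - z) * H z := by
  refine Integrable.mono' ((integrable_inv_norm_pow_mul (s := 1) (by norm_num) hH x).const_mul
    normConst⁻¹) ?_ (Eventually.of_forall fun z => ?_)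
  · exact ((measurable_ker k).comp (measurable_const.sub measurable_id)).aestronglyMeasurable.mul
      hH.integrable.aestronglyMeasurable
  · rw [norm_mul, pow_one, ← mul_assoc]
    exact mul_le_mul_of_nonneg_right (abs_ker_le hk _) (abs_nonneg _)

/-- By convexity of `exp`, `(1 - e^{-ka})/a` decreases in `a`, so screening only shrinks the
differences of the Newtonian kernel. -/
lemma yukawa_sub_le {k a b : ℝ} (hk : 0 ≤ k) (ha : 0 < a) (hab : a ≤ b) :
    |Real.exp (-k * a) / a - Real.exp (-k * b) / b| ≤ a⁻¹ - b⁻¹ := by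
  have hb : 0 < b := ha.trans_le hab
  have hmono : Real.exp (-k * b) ≤ Real.exp (-k * a) := by
    apply Real.exp_le_exp.2
    nlinarith
  rw [abs_of_nonneg]
  -- The point `-k a` is the convex combination of `-k b` and `0` with weight `a / b` on the former.
  · have hconv := convexOn_exp.2 (mem_univ (-k * b)) (mem_univ (0 : ℝ))
      (show 0 ≤ a / b by positivity)
      (show 0 ≤ 1 - a / b by rw [sub_nonneg, div_le_one hb]; exact hab) (by ring)
    have harg : (a / b) • (-k * b) + (1 - a / b) • (0 : ℝ) = -k * a := by
      simp only [smul_eq_mul]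
      field_simp
      ring
    rw [harg, Real.exp_zero] at hconv
    simp only [smul_eq_mul, mul_one] at hconv
    have h2 : Real.exp (-k * a) / a ≤ (a / b * Real.exp (-k * b) + (1 - a / b)) / a := by gcongr
    have h3 : (a / b * Real.exp (-k * b) + (1 - a / b)) / a =
        Real.exp (-k * b) / b + (a⁻¹ - b⁻¹) := by
      field_simp
    linarith
  · rw [sub_nonneg]
    gcongr

lemma abs_yukawa_sub_le {k a b : ℝ} (hk : 0 ≤ k) (ha : 0 < a) (hb : 0 < b) :
    |Real.exp (-k * a) / a - Real.exp (-k * b) / b| ≤ |b - a| * (a⁻¹ * b⁻¹) := by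
  have key : ∀ {a b : ℝ}, 0 < a → a ≤ b → a⁻¹ - b⁻¹ = |b - a| * (a⁻¹ * b⁻¹) := by
    intro a b ha hab
    have hb : 0 < b := ha.trans_le hab
    rw [abs_of_nonneg (by linarith)]
    field_simp
  rcases le_total a b with h | h
  · exact (yukawa_sub_le hk ha h).trans_eq (key ha h)
  · rw [abs_sub_comm, abs_sub_comm b a, mul_comm a⁻¹]
    exact (yukawa_sub_le hk hb h).trans_eq (key hb h)

lemma abs_ker_sub_le {k : ℝ} (hk : 0 ≤ k) {v w : E3} (hv : v ≠ 0) (hw : w ≠ 0) :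
    |ker k v - ker k w| ≤ normConst⁻¹ * (|‖w‖ - ‖v‖| * (‖v‖⁻¹ * ‖w‖⁻¹)) := by
  have := normConst_pos
  rw [ker, ker, ← mul_sub, abs_mul, abs_neg, abs_of_pos (by positivity : 0 < normConst⁻¹)]
  gcongr
  exact abs_yukawa_sub_le hk (norm_pos_iff.2 hv) (norm_pos_iff.2 hw)

/-- The kernel difference is at most `‖x - x'‖` times the product of the two inverse distances,
hence times half the sum of their squares. Inverse squares are locally integrable in dimension
three, uniformly in the centre. -/
theorem exists_lipschitz_conv_ker {k : ℝ} (hk : 0 ≤ k) {H : E3 → ℝ} (hH : Admissible H) :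
    ∃ C : NNReal, LipschitzWith C (conv (ker k) H) := by
  obtain ⟨C, hC⟩ := exists_integral_inv_norm_pow_mul_le (s := 2) (by norm_num) hH
  have hN := normConst_pos
  have hC0 : 0 ≤ C := (integral_nonneg fun z => by positivity).trans (hC 0)
  refine ⟨(normConst⁻¹ * C).toNNReal, LipschitzWith.of_dist_le_mul fun x x' => ?_⟩
  have hi := integrable_inv_norm_pow_mul (s := 2) (by norm_num) hH
  rw [Real.coe_toNNReal _ (by positivity), dist_eq_norm, dist_eq_norm]
  unfold conv
  rw [← integral_sub (integrable_ker_mul hk hH x) (integrable_ker_mul hk hH x')]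
  have hb : Integrable fun z => normConst⁻¹ * ‖x - x'‖ * 2⁻¹ *
      (‖x - z‖⁻¹ ^ 2 * |H z| + ‖x' - z‖⁻¹ ^ 2 * |H z|) := ((hi x).add (hi x')).const_mul _
  refine (norm_integral_le_of_norm_le hb ?_).trans ?_
  · filter_upwards [Measure.ae_ne volume x, Measure.ae_ne volume x'] with z hz hz'
    have h1 := abs_ker_sub_le hk (sub_ne_zero.2 hz.symm) (sub_ne_zero.2 hz'.symm)
    have h2 : |‖x' - z‖ - ‖x - z‖| ≤ ‖x - x'‖ := by
      refine (abs_norm_sub_norm_le _ _).trans_eq ?_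
      rw [sub_sub_sub_cancel_right, norm_sub_rev]
    have h3 : ‖x - z‖⁻¹ * ‖x' - z‖⁻¹ ≤ 2⁻¹ * (‖x - z‖⁻¹ ^ 2 + ‖x' - z‖⁻¹ ^ 2) := by
      nlinarith [sq_nonneg (‖x - z‖⁻¹ - ‖x' - z‖⁻¹)]
    rw [← sub_mul, norm_mul, Real.norm_eq_abs, Real.norm_eq_abs]
    calc |ker k (x - z) - ker k (x' - z)| * |H z|
        ≤ (normConst⁻¹ * (‖x - x'‖ * (2⁻¹ * (‖x - z‖⁻¹ ^ 2 + ‖x' - z‖⁻¹ ^ 2)))) * |H z| := by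
          refine mul_le_mul_of_nonneg_right (h1.trans ?_) (abs_nonneg _)
          gcongr
      _ = _ := by ring
  · rw [integral_const_mul, integral_add (hi x) (hi x')]
    have h5 : 0 ≤ normConst⁻¹ * ‖x - x'‖ * 2⁻¹ := by positivity
    calc _ ≤ normConst⁻¹ * ‖x - x'‖ * 2⁻¹ * (C + C) :=
          mul_le_mul_of_nonneg_left (add_le_add (hC x) (hC x')) h5
      _ = _ := by ring

/-! ### Kernels all of whose derivatives are bounded -/

/-- Smooth functions all of whose derivatives are bounded. -/
structure SmoothBounded (K : E3 → ℝ) : Prop where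
  smooth : ContDiff ℝ ∞ K
  bounded : ∀ n : ℕ, ∃ C, ∀ x, ‖iteratedFDeriv ℝ n K x‖ ≤ C

lemma SmoothBounded.fderiv_apply {K : E3 → ℝ} (hK : SmoothBounded K) (y : E3) :
    SmoothBounded fun x => fderiv ℝ K x y := by
  have hs : ContDiff ℝ ∞ (fderiv ℝ K) := hK.smooth.fderiv_right (m := ∞) (by simp)
  refine ⟨hs.clm_apply contDiff_const, fun n => ?_⟩
  obtain ⟨C, hC⟩ := hK.bounded (n + 1)
  refine ⟨‖y‖ * C, fun x => ?_⟩
  refine (norm_iteratedFDeriv_clm_apply_const (n := n) hs.contDiffAt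
    (by exact_mod_cast le_top)).trans ?_
  rw [norm_iteratedFDeriv_fderiv]
  exact mul_le_mul_of_nonneg_left (hC x) (norm_nonneg y)

lemma SmoothBounded.integrable_mul {K : E3 → ℝ} (hK : SmoothBounded K) {H : E3 → ℝ}
    (hH : Integrable H) (x : E3) : Integrable fun z => K (x - z) * H z := by
  obtain ⟨C, hC⟩ := hK.bounded 0
  refine hH.bdd_mul (c := C) ?_ (Eventually.of_forall fun z => ?_)
  · exact (hK.smooth.continuous.comp (by fun_prop)).aestronglyMeasurable
  · simpa using hC (x - z)

lemma SmoothBounded.hasFDerivAt_conv {K : E3 → ℝ} (hK : SmoothBounded K) {H : E3 → ℝ}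
    (hH : Integrable H) (x : E3) :
    HasFDerivAt (conv K H) (∫ z, H z • fderiv ℝ K (x - z)) x := by
  obtain ⟨C, hC⟩ := hK.bounded 1
  have hd : Continuous (fderiv ℝ K) := hK.smooth.continuous_fderiv (by simp)
  refine hasFDerivAt_integral_of_dominated_of_fderiv_le (s := univ) (bound := fun z => |H z| * C)
    (F' := fun x z => H z • fderiv ℝ K (x - z)) univ_mem
    (Eventually.of_forall fun x => (hK.integrable_mul hH x).aestronglyMeasurable)
    (hK.integrable_mul hH x) ?_ ?_ (hH.abs.mul_const C) ?_
  · exact hH.aestronglyMeasurable.smul (hd.comp (by fun_prop)).aestronglyMeasurable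
  · refine Eventually.of_forall fun z x _ => ?_
    rw [norm_smul, Real.norm_eq_abs]
    gcongr
    have := hC (x - z)
    rwa [← norm_iteratedFDeriv_one]
  · refine Eventually.of_forall fun z x _ => ?_
    have h1 : HasFDerivAt (fun x => K (x - z)) (fderiv ℝ K (x - z)) x := by
      have := (hK.smooth.differentiable (by simp) (x - z)).hasFDerivAt.comp x
        ((hasFDerivAt_id x).sub_const z)
      simpa using! this
    exact h1.mul_const (H z)

lemma SmoothBounded.fderiv_conv {K : E3 → ℝ} (hK : SmoothBounded K) {H : E3 → ℝ}
    (hH : Integrable H) (x y : E3) :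
    fderiv ℝ (conv K H) x y = conv (fun w => fderiv ℝ K w y) H x := by
  obtain ⟨C, hC⟩ := hK.bounded 1
  have hd : Continuous (fderiv ℝ K) := hK.smooth.continuous_fderiv (by simp)
  have hint : Integrable fun z => H z • fderiv ℝ K (x - z) := by
    refine Integrable.mono' (hH.abs.mul_const C)
      (hH.aestronglyMeasurable.smul (hd.comp (by fun_prop)).aestronglyMeasurable)
      (Eventually.of_forall fun z => ?_)
    rw [norm_smul, Real.norm_eq_abs]
    gcongr
    have := hC (x - z)
    rwa [← norm_iteratedFDeriv_one]
  rw [(hK.hasFDerivAt_conv hH x).fderiv, ContinuousLinearMap.integral_apply hint, conv]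
  simp [mul_comm]

/-- All derivatives fall on the kernel, so the density need only be integrable. The class of kernels
is stable under directional derivatives, which drives the induction. -/
theorem SmoothBounded.contDiff_conv {K : E3 → ℝ} (hK : SmoothBounded K) {H : E3 → ℝ}
    (hH : Integrable H) : ContDiff ℝ ∞ (conv K H) := by
  rw [contDiff_infty]
  intro n
  induction n generalizing K with
  | zero =>
    simp only [Nat.cast_zero, contDiff_zero]
    exact continuous_iff_continuousAt.2 fun x => (hK.hasFDerivAt_conv hH x).continuousAt
  | succ n ih =>
    rw [Nat.cast_succ, contDiff_succ_iff_fderiv_apply]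
    refine ⟨fun x => (hK.hasFDerivAt_conv hH x).differentiableAt, by simp, fun y => ?_⟩
    have : (fun x => fderiv ℝ (conv K H) x y) = conv (fun w => fderiv ℝ K w y) H :=
      funext fun x => hK.fderiv_conv hH x y
    rw [this]
    exact ih (hK.fderiv_apply y)

lemma SmoothBounded.pd_conv {K : E3 → ℝ} (hK : SmoothBounded K) {H : E3 → ℝ}
    (hH : Integrable H) (i : Fin 3) : pd i (conv K H) = conv (pd i K) H :=
  funext fun x => hK.fderiv_conv hH x (e i)

lemma SmoothBounded.pd {K : E3 → ℝ} (hK : SmoothBounded K) (i : Fin 3) :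
    SmoothBounded (pd i K) :=
  hK.fderiv_apply (e i)

/-! ### The kernel away from its singularity -/

lemma uniqueDiffOn_compl_zero : UniqueDiffOn ℝ ({0}ᶜ : Set E3) :=
  isOpen_compl_singleton.uniqueDiffOn

/-- Scaling of iterated derivatives of functions on the punctured space. -/
lemma norm_iteratedFDerivWithin_comp_smul_le (h : E3 → ℝ) (n : ℕ) {a : ℝ} (ha : 0 < a) {z : E3}
    (hz : z ≠ 0) :
    ‖iteratedFDerivWithin ℝ n (fun w => h (a • w)) {0}ᶜ z‖ ≤
      a ^ n * ‖iteratedFDerivWithin ℝ n h {0}ᶜ (a • z)‖ := by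
  let L : E3 ≃L[ℝ] E3 := ContinuousLinearEquiv.smulLeft (Units.mk0 a ha.ne')
  have hL : ∀ w, L w = a • w := fun w => rfl
  have hpre : L ⁻¹' ({0}ᶜ : Set E3) = {0}ᶜ := by
    ext w
    simp [hL, ha.ne']
  have h1 := L.iteratedFDerivWithin_comp_right h uniqueDiffOn_compl_zero (x := z)
    (by simpa [hL, ha.ne'] using hz) n
  rw [hpre] at h1
  change ‖iteratedFDerivWithin ℝ n (h ∘ L) {0}ᶜ z‖ ≤ _
  rw [h1, ← hL]
  refine (ContinuousMultilinearMap.norm_compContinuousLinearMap_le _ _).trans ?_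
  rw [mul_comm]
  gcongr
  simp only [Finset.prod_const, Finset.card_univ, Fintype.card_fin]
  gcongr
  refine ContinuousLinearMap.opNorm_le_bound _ ha.le fun w => ?_
  change ‖L w‖ ≤ _
  rw [hL, norm_smul, Real.norm_of_nonneg ha.le]

/-- A smooth function, homogeneous under contractions with weight `b`, has bounded derivatives
outside the unit ball. -/
lemma exists_bound_of_homogeneous {h : E3 → ℝ} (hs : ContDiffOn ℝ ∞ h {0}ᶜ) {b : ℝ → ℝ} {n : ℕ}
    (hb : ∀ a, 0 < a → a ≤ 1 → ∀ w, h w = b a * h (a • w))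
    (hbn : ∀ a, 0 < a → a ≤ 1 → |b a| * a ^ n ≤ 1) :
    ∃ C, ∀ z : E3, 1 ≤ ‖z‖ → ‖iteratedFDerivWithin ℝ n h {0}ᶜ z‖ ≤ C := by
  have hcont : ContinuousOn (iteratedFDerivWithin ℝ n h {0}ᶜ) (sphere 0 1) :=
    (hs.continuousOn_iteratedFDerivWithin (by exact_mod_cast le_top)
      uniqueDiffOn_compl_zero).mono fun z hz => by
        have : ‖z‖ = 1 := by simpa using hz
        simp only [mem_compl_iff, mem_singleton_iff]
        rintro rfl
        simp at this
  obtain ⟨C, hC⟩ := (isCompact_sphere (0 : E3) 1).exists_bound_of_continuousOn hcont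
  refine ⟨C, fun z hz => ?_⟩
  have hz0 : 0 < ‖z‖ := by linarith
  have hzne : z ≠ 0 := norm_pos_iff.1 hz0
  set a := ‖z‖⁻¹ with ha
  have ha0 : 0 < a := by positivity
  have ha1 : a ≤ 1 := inv_le_one_of_one_le₀ hz
  have haz : ‖a • z‖ = 1 := by
    rw [norm_smul, Real.norm_of_nonneg ha0.le, ha, inv_mul_cancel₀ hz0.ne']
  have hC' := hC (a • z) (by simpa using haz)
  have heq : h = b a • fun w => h (a • w) := funext fun w => hb a ha0 ha1 w
  have hsm : ContDiffOn ℝ ∞ (fun w => h (a • w)) {0}ᶜ :=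
    hs.comp (by fun_prop) fun w hw => by simpa [ha0.ne'] using hw
  have h1 : ‖iteratedFDerivWithin ℝ n h {0}ᶜ z‖ =
      |b a| * ‖iteratedFDerivWithin ℝ n (fun w => h (a • w)) {0}ᶜ z‖ := by
    conv_lhs => rw [heq]
    rw [iteratedFDerivWithin_const_smul_apply ((hsm z hzne).of_le (by exact_mod_cast le_top))
      uniqueDiffOn_compl_zero hzne, norm_smul, Real.norm_eq_abs]
  rw [h1]
  have h2 := norm_iteratedFDerivWithin_comp_smul_le h n ha0 hzne
  calc |b a| * ‖iteratedFDerivWithin ℝ n (fun w => h (a • w)) {0}ᶜ z‖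
      ≤ |b a| * (a ^ n * C) := by gcongr; exact h2.trans (by gcongr)
    _ = (|b a| * a ^ n) * C := by ring
    _ ≤ 1 * C := by
        have : 0 ≤ C := (norm_nonneg _).trans hC'
        gcongr
        exact hbn a ha0 ha1
    _ = C := one_mul C

lemma contDiffOn_norm_compl_zero : ContDiffOn ℝ ∞ (fun z : E3 => ‖z‖) {0}ᶜ :=
  fun _ hz => (contDiffAt_norm ℝ hz).contDiffWithinAt

/-- Order zero is excluded because the norm itself is unbounded; in the scaling estimate one factor
`a` has to cancel the weight `a⁻¹`. -/
lemma exists_bound_norm (n : ℕ) (hn : 1 ≤ n) :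
    ∃ C, ∀ z : E3, 1 ≤ ‖z‖ → ‖iteratedFDerivWithin ℝ n (fun z : E3 => ‖z‖) {0}ᶜ z‖ ≤ C := by
  refine exists_bound_of_homogeneous contDiffOn_norm_compl_zero (b := fun a => a⁻¹) ?_ ?_
  · intro a ha _ w
    rw [norm_smul, Real.norm_of_nonneg ha.le, inv_mul_cancel_left₀ ha.ne']
  · intro a ha ha1
    rw [abs_of_pos (by positivity)]
    calc a⁻¹ * a ^ n ≤ a⁻¹ * a ^ 1 := by
          gcongr a⁻¹ * ?_
          exact pow_le_pow_of_le_one ha.le ha1 hn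
      _ = 1 := by rw [pow_one, inv_mul_cancel₀ ha.ne']

lemma exists_bound_inv_norm (n : ℕ) :
    ∃ C, ∀ z : E3, 1 ≤ ‖z‖ → ‖iteratedFDerivWithin ℝ n (fun z : E3 => ‖z‖⁻¹) {0}ᶜ z‖ ≤ C := by
  refine exists_bound_of_homogeneous
    (contDiffOn_norm_compl_zero.inv fun z hz => norm_ne_zero_iff.2 hz) (b := fun a => a) ?_ ?_
  · intro a ha _ w
    simp only [Pi.inv_apply]
    rw [norm_smul, Real.norm_of_nonneg ha.le, mul_inv, mul_inv_cancel_left₀ ha.ne']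
  · intro a ha ha1
    rw [abs_of_pos ha]
    exact mul_le_one₀ ha1 (by positivity) (pow_le_one₀ ha.le ha1)

lemma exists_bound_exp_norm {k : ℝ} (hk : 0 ≤ k) (n : ℕ) :
    ∃ C, ∀ z : E3, 1 ≤ ‖z‖ →
      ‖iteratedFDerivWithin ℝ n (fun z : E3 => Real.exp (-k * ‖z‖)) {0}ᶜ z‖ ≤ C := by
  have hex : ∀ i : ℕ, ∃ C, 1 ≤ i → ∀ z : E3, 1 ≤ ‖z‖ →
      ‖iteratedFDerivWithin ℝ i (fun z : E3 => ‖z‖) {0}ᶜ z‖ ≤ C := by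
    intro i
    by_cases hi : 1 ≤ i
    -- Order `0` carries no bound and receives the dummy constant `0`.
    · obtain ⟨C, hC⟩ := exists_bound_norm i hi
      exact ⟨C, fun _ => hC⟩
    · exact ⟨0, fun h => absurd h hi⟩
  choose B hB using hex
  set D : ℝ := 1 + ∑ i ∈ Finset.range (n + 1), |B i| with hD
  have hD1 : 1 ≤ D := by
    have : 0 ≤ ∑ i ∈ Finset.range (n + 1), |B i| := Finset.sum_nonneg fun i _ => abs_nonneg _
    linarith
  refine ⟨n.factorial * (1 + k) ^ n * D ^ n, fun z hz => ?_⟩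
  have hz0 : z ≠ 0 := norm_pos_iff.1 (by linarith)
  refine norm_iteratedFDerivWithin_comp_le (g := fun s => Real.exp (-k * s)) (t := univ) (N := ∞)
    (f := fun z : E3 => ‖z‖) (by fun_prop) contDiffOn_norm_compl_zero (by exact_mod_cast le_top)
    uniqueDiffOn_univ uniqueDiffOn_compl_zero (mapsTo_univ _ _) hz0 (fun i hi => ?_)
    (fun i hi1 hi => ?_)
  · rw [iteratedFDerivWithin_univ, norm_iteratedFDeriv_eq_norm_iteratedDeriv,
      iteratedDeriv_exp_const_mul]
    simp only [norm_mul, norm_pow, norm_neg, Real.norm_of_nonneg hk, Real.norm_eq_abs, Real.abs_exp]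
    have h1 : Real.exp (-k * ‖z‖) ≤ 1 := by
      rw [Real.exp_le_one_iff]
      have := mul_nonneg hk (norm_nonneg z)
      linarith
    calc k ^ i * Real.exp (-k * ‖z‖) ≤ (1 + k) ^ i * 1 := by gcongr; linarith
      _ ≤ (1 + k) ^ n := by
          rw [mul_one]
          exact pow_le_pow_right₀ (by linarith) hi
  · calc _ ≤ B i := hB i hi1 z hz
      _ ≤ |B i| := le_abs_self _
      _ ≤ ∑ i ∈ Finset.range (n + 1), |B i| :=
          Finset.single_le_sum (f := fun i => |B i|) (fun i _ => abs_nonneg _)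
            (Finset.mem_range.2 (by omega))
      _ ≤ D := by linarith
      _ ≤ D ^ i := le_self_pow₀ hD1 (by omega)

lemma contDiffOn_ker (k : ℝ) : ContDiffOn ℝ ∞ (ker k) {0}ᶜ := by
  unfold ker
  exact contDiffOn_const.mul (((contDiffOn_const.mul contDiffOn_norm_compl_zero).exp).div
    contDiffOn_norm_compl_zero fun z hz => norm_ne_zero_iff.2 hz)

lemma exists_bound_ker {k : ℝ} (hk : 0 ≤ k) (n : ℕ) :
    ∃ C, ∀ z : E3, 1 ≤ ‖z‖ → ‖iteratedFDeriv ℝ n (ker k) z‖ ≤ C := by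
  choose A hA using exists_bound_exp_norm hk
  choose B hB using exists_bound_inv_norm
  refine ⟨|-normConst⁻¹| * ∑ i ∈ Finset.range (n + 1), (n.choose i : ℝ) * A i * B (n - i),
    fun z hz => ?_⟩
  have hz0 : z ≠ 0 := norm_pos_iff.1 (by linarith)
  have hs1 : ContDiffOn ℝ ∞ (fun z : E3 => Real.exp (-k * ‖z‖)) {0}ᶜ :=
    (contDiffOn_const.mul contDiffOn_norm_compl_zero).exp
  have hs2 : ContDiffOn ℝ ∞ (fun z : E3 => ‖z‖⁻¹) {0}ᶜ :=
    contDiffOn_norm_compl_zero.inv fun z hz => norm_ne_zero_iff.2 hz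
  rw [← iteratedFDerivWithin_of_isOpen n isOpen_compl_singleton hz0]
  have heq : ker k = (-normConst⁻¹) • fun z : E3 => Real.exp (-k * ‖z‖) * ‖z‖⁻¹ := by
    ext z
    simp [ker, div_eq_mul_inv]
  rw [heq, iteratedFDerivWithin_const_smul_apply
    (((hs1.mul hs2) z hz0).of_le (by exact_mod_cast le_top)) uniqueDiffOn_compl_zero hz0,
    norm_smul, Real.norm_eq_abs]
  gcongr
  refine (norm_iteratedFDerivWithin_mul_le hs1 hs2 uniqueDiffOn_compl_zero hz0
    (by exact_mod_cast le_top)).trans ?_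
  refine Finset.sum_le_sum fun i _ => ?_
  have hA0 : 0 ≤ A i := (norm_nonneg _).trans (hA i z hz)
  gcongr
  · exact hA i z hz
  · exact hB (n - i) z hz

/-- The kernel with its singularity cut off. -/
def cutKer (k : ℝ) (χ : ContDiffBump (0 : E3)) (z : E3) : ℝ := (1 - χ z) * ker k z

lemma cutKer_of_le (k : ℝ) (χ : ContDiffBump (0 : E3)) {z : E3} (hz : χ.rOut ≤ ‖z‖) :
    cutKer k χ z = ker k z := by
  rw [cutKer, χ.zero_of_le_dist (by simpa using hz)]
  ring

lemma cutKer_eventuallyEq (k : ℝ) (χ : ContDiffBump (0 : E3)) {z : E3} (hz : χ.rOut < ‖z‖) :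
    cutKer k χ =ᶠ[𝓝 z] ker k :=
  (continuous_norm.continuousAt.eventually (lt_mem_nhds hz)).mono
    fun _ hw => cutKer_of_le k χ (le_of_lt hw)

/-- The cut kernel vanishes near the origin, is controlled by compactness on a ball, and coincides
with `ker k` outside it. -/
lemma smoothBounded_cutKer {k : ℝ} (hk : 0 ≤ k) (χ : ContDiffBump (0 : E3)) :
    SmoothBounded (cutKer k χ) := by
  have hs : ContDiff ℝ ∞ (cutKer k χ) := by
    refine contDiff_iff_contDiffAt.2 fun z => ?_
    by_cases hz : z = 0
    · have : cutKer k χ =ᶠ[𝓝 z] fun _ => 0 := by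
        filter_upwards [χ.eventuallyEq_one.filter_mono (by rw [hz])] with w hw
        simp only [cutKer, hw, Pi.one_apply, sub_self, zero_mul]
      exact contDiffAt_const.congr_of_eventuallyEq this
    · exact (contDiffAt_const.sub χ.contDiffAt).mul
        ((contDiffOn_ker k).contDiffAt (isOpen_compl_singleton.mem_nhds hz))
  refine ⟨hs, fun n => ?_⟩
  obtain ⟨C, hC⟩ := exists_bound_ker hk n
  obtain ⟨C', hC'⟩ := (isCompact_closedBall (0 : E3) (max 1 χ.rOut)).exists_bound_of_continuousOn
    (hs.continuous_iteratedFDeriv (m := n) (by exact_mod_cast le_top)).continuousOn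
  refine ⟨max C C', fun z => ?_⟩
  by_cases hz : ‖z‖ ≤ max 1 χ.rOut
  · exact (hC' z (by simpa using hz)).trans (le_max_right _ _)
  · rw [not_le, max_lt_iff] at hz
    rw [(cutKer_eventuallyEq k χ hz.2).iteratedFDeriv ℝ n |>.eq_of_nhds]
    exact (hC z hz.1.le).trans (le_max_left _ _)

lemma sum_pd_pd_ker (k : ℝ) {z : E3} (hz : z ≠ 0) :
    ∑ i, pd i (pd i (ker k)) z = k ^ 2 * ker k z := by
  have hz' : 0 < ‖z‖ ^ 2 + 0 := by
    have := norm_pos_iff.2 hz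
    positivity
  have h1 : ∀ (i : Fin 3) {f : E3 → ℝ} {w : E3} (c : ℝ),
      pd i (fun z => c * f z) w = c * pd i f w := by
    intro i f w c
    change fderiv ℝ (c • f) w (e i) = _
    rw [fderiv_const_smul_field]
    rfl
  have h2 : ker k = fun z => -normConst⁻¹ * prof k (‖z‖ ^ 2 + 0) := funext (ker_eq_prof k)
  have h3 : ∀ i : Fin 3, pd i (ker k) =
      fun z => -normConst⁻¹ * pd i (fun z => prof k (‖z‖ ^ 2 + 0)) z := fun i => by
    rw [h2]
    exact funext fun w => h1 i _
  simp only [h3, h1, ← Finset.mul_sum]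
  rw [sum_pd_pd_prof k hz', ker_eq_prof]
  ring

/-! ### Interior regularity of potentials -/

lemma conv_eq_integral (K H : E3 → ℝ) (x : E3) : conv K H x = ∫ t, K t * H (x - t) := by
  rw [← integral_sub_left_eq_self (fun t => K t * H (x - t)) volume x]
  simp [conv]

lemma conv_eq_convolution (K H : E3 → ℝ) :
    conv K H = convolution K H (ContinuousLinearMap.mul ℝ ℝ) volume := by
  ext x
  rw [conv_eq_integral]
  rfl

lemma pd_conv_ker {k : ℝ} (hk : 0 ≤ k) {g : E3 → ℝ} (hg : ContDiff ℝ ∞ g)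
    (hc : HasCompactSupport g) (i : Fin 3) :
    pd i (conv (ker k) g) = conv (ker k) (pd i g) := by
  ext x
  have hg1 : ContDiff ℝ 1 g := hg.of_le (by simp)
  rw [conv_eq_convolution, conv_eq_convolution, pd,
    (hc.hasFDerivAt_convolution_right _ (locallyIntegrable_ker hk) hg1 x).fderiv,
    convolution_precompR_apply _ (locallyIntegrable_ker hk) (hc.fderiv ℝ)
      (hg1.continuous_fderiv (by simp))]
  rfl

lemma contDiff_conv_ker {k : ℝ} (hk : 0 ≤ k) {g : E3 → ℝ} (hg : ContDiff ℝ ∞ g)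
    (hc : HasCompactSupport g) : ContDiff ℝ ∞ (conv (ker k) g) := by
  rw [conv_eq_convolution]
  exact hc.contDiff_convolution_right _ (locallyIntegrable_ker hk) hg

lemma integrable_ker_mul_comp_sub {k : ℝ} (hk : 0 ≤ k) {g : E3 → ℝ} (hg : Continuous g)
    (hc : HasCompactSupport g) (x : E3) : Integrable fun t => ker k t * g (x - t) :=
  hc.convolutionExists_right (ContinuousLinearMap.mul ℝ ℝ) (locallyIntegrable_ker hk) hg x

lemma pd_comp_sub {g : E3 → ℝ} (hg : Differentiable ℝ g) (x : E3) (i : Fin 3) :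
    pd i (fun t => g (x - t)) = fun t => -pd i g (x - t) := by
  ext t
  have h := (hg (x - t)).hasFDerivAt.comp t ((hasFDerivAt_id t).const_sub x)
  change fderiv ℝ (g ∘ fun t => x - t) t (e i) = _
  rw [h.fderiv]
  simp [pd]

/-- Both derivatives are moved onto `g`, and the fundamental-solution identity is applied to the
test function `t ↦ g (x - t)`. -/
theorem sum_pd_pd_conv_ker {k : ℝ} (hk : 0 ≤ k) {g : E3 → ℝ} (hg : ContDiff ℝ ∞ g)
    (hc : HasCompactSupport g) (x : E3) :
    ∑ i, pd i (pd i (conv (ker k) g)) x - k ^ 2 * conv (ker k) g x = g x := by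
  have h0 : ∀ i, pd i (pd i (conv (ker k) g)) x = ∫ t, ker k t * pd i (pd i g) (x - t) := by
    intro i
    rw [pd_conv_ker hk hg hc, pd_conv_ker hk (contDiff_pd hg i) (hasCompactSupport_pd hc i),
      conv_eq_integral]
  have hi : ∀ i, Integrable fun t => ker k t * pd i (pd i g) (x - t) := fun i =>
    integrable_ker_mul_comp_sub hk (contDiff_pd (contDiff_pd hg i) i).continuous
      (hasCompactSupport_pd (hasCompactSupport_pd hc i) i) x
  have hi' := integrable_ker_mul_comp_sub hk hg.continuous hc x
  have hcx : HasCompactSupport fun t => g (x - t) :=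
    hc.comp_homeomorph (Homeomorph.subLeft x)
  have key := integral_ker_mul hk (g := fun t => g (x - t)) (hg.comp (by fun_prop)) hcx
  have hpp : ∀ i t, pd i (pd i fun t => g (x - t)) t = pd i (pd i g) (x - t) := by
    intro i t
    rw [pd_comp_sub (hg.differentiable (by simp))]
    have h1 := pd_comp_sub ((contDiff_pd hg i).differentiable (by simp)) x i
    have h2 : pd i (fun t => -pd i g (x - t)) t = -pd i (fun t => pd i g (x - t)) t := by
      unfold pd
      rw [fderiv_fun_neg]
      rfl
    rw [h2, h1, neg_neg]
  simp only [hpp, sub_zero] at key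
  rw [← key, conv_eq_integral]
  simp only [h0]
  rw [← integral_finsetSum _ fun i _ => hi i, ← integral_const_mul,
    ← integral_sub (integrable_finsetSum _ fun i _ => hi i) (hi'.const_mul _)]
  refine integral_congr_ae (Eventually.of_forall fun t => ?_)
  simp only [Fin.sum_univ_three]
  ring

/-- Where the density vanishes, the potential is smooth and solves the homogeneous equation. -/
lemma contDiffAt_conv_ker_of_eventually_zero {k : ℝ} (hk : 0 ≤ k) {H : E3 → ℝ}
    (hH : Integrable H) {p : E3} (h0 : H =ᶠ[𝓝 p] 0) :
    ContDiffAt ℝ ∞ (conv (ker k) H) p ∧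
      ∑ i, pd i (pd i (conv (ker k) H)) p = k ^ 2 * conv (ker k) H p := by
  obtain ⟨r, hr, hball⟩ := Metric.eventually_nhds_iff_ball.1 h0
  -- For `x` within `r / 2` of `p`, every `z` with `H z ≠ 0` has `‖x - z‖ > r / 2`, so cutting off
  -- the kernel inside that radius does not change the potential.
  let χ : ContDiffBump (0 : E3) := ⟨r / 4, r / 2, by positivity, by linarith⟩
  have hK := smoothBounded_cutKer hk χ
  have hfar : ∀ x ∈ ball p (r / 2), ∀ z, H z ≠ 0 → χ.rOut < ‖x - z‖ := by
    intro x hx z hz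
    have h1 : ¬ dist z p < r := fun h => hz (hball z h)
    have h2 : dist x p < r / 2 := hx
    have h3 := dist_triangle_left z p x
    rw [← dist_eq_norm]
    change r / 2 < _
    linarith
  have heq : ∀ x ∈ ball p (r / 2), conv (ker k) H x = conv (cutKer k χ) H x := by
    intro x hx
    refine integral_congr_ae (Eventually.of_forall fun z => ?_)
    by_cases hz : H z = 0
    · simp [hz]
    · simp only
      rw [cutKer_of_le k χ (hfar x hx z hz).le]
  have hev : conv (ker k) H =ᶠ[𝓝 p] conv (cutKer k χ) H :=
    eventually_of_mem (ball_mem_nhds p (by positivity)) heq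
  refine ⟨(hK.contDiff_conv hH).contDiffAt.congr_of_eventuallyEq hev, ?_⟩
  have hp : p ∈ ball p (r / 2) := mem_ball_self (by positivity)
  have h1 : ∀ i, pd i (pd i (conv (ker k) H)) p = conv (pd i (pd i (cutKer k χ))) H p := by
    intro i
    rw [(pd_congr (pd_congr hev i) i).eq_of_nhds, hK.pd_conv hH, (hK.pd i).pd_conv hH]
  simp only [h1, heq p hp]
  unfold conv
  rw [← integral_finsetSum _ fun i _ => ((hK.pd i).pd i).integrable_mul hH p, ← integral_const_mul]
  refine integral_congr_ae (Eventually.of_forall fun z => ?_)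
  by_cases hz : H z = 0
  · simp [hz]
  · have hlt := hfar p hp z hz
    have hne : p - z ≠ 0 := norm_pos_iff.1 (lt_trans χ.rOut_pos hlt)
    have hev' := cutKer_eventuallyEq k χ hlt
    simp only
    rw [← Finset.sum_mul, cutKer_of_le k χ hlt.le, ← mul_assoc, ← sum_pd_pd_ker k hne]
    congr 1
    exact Finset.sum_congr rfl fun i _ => (pd_congr (pd_congr hev' i) i).eq_of_nhds

lemma Admissible.mul_of_abs_le_one {H φ : E3 → ℝ} (hH : Admissible H) (hφ : Continuous φ)
    (hφ1 : ∀ x, |φ x| ≤ 1) : Admissible fun x => φ x * H x := by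
  obtain ⟨M, hM⟩ := hH.bounded
  refine ⟨hH.integrable.bdd_mul hφ.aestronglyMeasurable (Eventually.of_forall hφ1), M, fun z => ?_⟩
  rw [abs_mul]
  have := mul_le_mul (hφ1 z) (hM z) (abs_nonneg _) zero_le_one
  linarith

lemma conv_ker_split {k : ℝ} (hk : 0 ≤ k) {H φ : E3 → ℝ} (hH : Admissible H) (hφ : Continuous φ)
    (hφ0 : ∀ x, 0 ≤ φ x) (hφ1 : ∀ x, φ x ≤ 1) :
    conv (ker k) H = fun x =>
      conv (ker k) (fun z => φ z * H z) x + conv (ker k) (fun z => (1 - φ z) * H z) x := by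
  ext x
  unfold conv
  rw [← integral_add]
  · refine integral_congr_ae (Eventually.of_forall fun z => ?_)
    simp only
    ring
  · exact integrable_ker_mul hk (hH.mul_of_abs_le_one hφ fun z => by
      rw [abs_of_nonneg (hφ0 z)]; exact hφ1 z) x
  · have hφc : Continuous fun z => 1 - φ z := continuous_const.sub hφ
    refine integrable_ker_mul hk (hH.mul_of_abs_le_one hφc fun z => ?_) x
    rw [abs_le]
    constructor <;> linarith [hφ0 z, hφ1 z]

/-- A bump at `p` splits `F` into a smooth compactly supported part, which produces the source term,
and a part vanishing near `p`, whose potential is smooth there and solves the homogeneous equation.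
-/
theorem interior_regularity {k : ℝ} (hk : 0 ≤ k) {F : E3 → ℝ} (hF : Admissible F) {U : Set E3}
    (hU : IsOpen U) (hs : ContDiffOn ℝ ∞ F U) {p : E3} (hp : p ∈ U) :
    ContDiffAt ℝ ∞ (conv (ker k) F) p ∧
      ∑ i, pd i (pd i (conv (ker k) F)) p - k ^ 2 * conv (ker k) F p = F p := by
  obtain ⟨r, hr, hrU⟩ := Metric.isOpen_iff.1 hU p hp
  let χ : ContDiffBump p := ⟨r / 4, r / 2, by positivity, by linarith⟩
  set F₁ : E3 → ℝ := fun z => χ z * F z with hF₁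
  set F₂ : E3 → ℝ := fun z => (1 - χ z) * F z with hF₂
  have hsplit : conv (ker k) F = fun x => conv (ker k) F₁ x + conv (ker k) F₂ x :=
    conv_ker_split hk hF χ.continuous (fun x => χ.nonneg) (fun x => χ.le_one)
  have hc : HasCompactSupport F₁ := χ.hasCompactSupport.mul_right
  have hsm : ContDiff ℝ ∞ F₁ := by
    refine contDiff_iff_contDiffAt.2 fun z => ?_
    by_cases hz : z ∈ U
    · exact χ.contDiffAt.mul (hs.contDiffAt (hU.mem_nhds hz))
    · have hz' : z ∉ tsupport χ := by
        rw [χ.tsupport_eq]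
        intro h
        refine hz (hrU ?_)
        have h1 : dist z p ≤ r / 2 := h
        rw [mem_ball]
        linarith
      have : F₁ =ᶠ[𝓝 z] fun _ => 0 := by
        filter_upwards [notMem_tsupport_iff_eventuallyEq.1 hz'] with w hw
        simp [hF₁, hw]
      exact contDiffAt_const.congr_of_eventuallyEq this
  have hF₂a : Admissible F₂ := hF.mul_of_abs_le_one (continuous_const.sub χ.continuous) fun z => by
    rw [abs_le]
    constructor <;> linarith [χ.nonneg (x := z), χ.le_one (x := z)]
  have h0 : F₂ =ᶠ[𝓝 p] 0 := by
    filter_upwards [χ.eventuallyEq_one] with w hw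
    simp [hF₂, hw]
  obtain ⟨hf1, hf2⟩ := contDiffAt_conv_ker_of_eventually_zero hk hF₂a.integrable h0
  have hn1 := (contDiff_conv_ker hk hsm hc)
  have hn2 := sum_pd_pd_conv_ker hk hsm hc p
  refine ⟨hsplit ▸ hn1.contDiffAt.add hf1, ?_⟩
  have hpd : ∀ i, pd i (pd i (conv (ker k) F)) p =
      pd i (pd i (conv (ker k) F₁)) p + pd i (pd i (conv (ker k) F₂)) p := by
    intro i
    have hev : pd i (conv (ker k) F) =ᶠ[𝓝 p]
        fun x => pd i (conv (ker k) F₁) x + pd i (conv (ker k) F₂) x := by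
      have hd : ∀ᶠ x in 𝓝 p, DifferentiableAt ℝ (conv (ker k) F₂) x :=
        ((hf1.of_le (m := 1) (by simp)).eventually (by simp)).mono fun x hx =>
          hx.differentiableAt (by simp)
      filter_upwards [hd] with x hx
      rw [hsplit]
      unfold pd
      rw [fderiv_fun_add (hn1.differentiable (by simp) x) hx]
      rfl
    have hd1 : DifferentiableAt ℝ (pd i (conv (ker k) F₁)) p :=
      (contDiff_pd hn1 i).differentiable (by simp) p
    have hd2 : DifferentiableAt ℝ (pd i (conv (ker k) F₂)) p :=
      (contDiffAt_pd hf1 i).differentiableAt (by simp)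
    unfold pd at hev hd1 hd2 ⊢
    rw [hev.fderiv_eq, fderiv_fun_add hd1 hd2]
    rfl
  have hone : χ p = 1 := χ.one_of_mem_closedBall (by simp [χ.rIn_pos.le])
  have hF₁p : F₁ p = F p := by simp [hF₁, hone]
  simp only [hpd, Finset.sum_add_distrib]
  rw [hf2, hsplit]
  simp only
  rw [← hF₁p, ← hn2]
  ring

/-! ### The half-space and odd reflection -/

lemma continuous_coord (i : Fin 3) : Continuous fun x : E3 => x i := by fun_prop

lemma isOpen_openHalf : IsOpen openHalf := isOpen_lt continuous_const (continuous_coord 2)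

lemma isClosed_closedHalf : IsClosed closedHalf := isClosed_le continuous_const (continuous_coord 2)

lemma openHalf_subset_closedHalf : openHalf ⊆ closedHalf := fun x hx =>
  show 0 ≤ x 2 from (show 0 < x 2 from hx).le

lemma convex_openHalf : Convex ℝ openHalf := by
  intro x hx y hy a b ha hb hab
  simp only [openHalf, mem_ofPred_eq, PiLp.add_apply, PiLp.smul_apply, smul_eq_mul] at *
  rcases ha.eq_or_lt with rfl | ha
  · simp_all
  · nlinarith [mul_pos ha hx, mul_nonneg hb hy.le]

lemma closure_openHalf : closure openHalf = closedHalf := by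
  refine Subset.antisymm (closure_minimal openHalf_subset_closedHalf isClosed_closedHalf) ?_
  intro x hx
  have hlim : Tendsto (fun s : ℝ => x + s • e 2) (𝓝[>] 0) (𝓝 x) := by
    have : Tendsto (fun s : ℝ => x + s • e 2) (𝓝 0) (𝓝 (x + (0 : ℝ) • e 2)) :=
      (by fun_prop : Continuous fun s : ℝ => x + s • e 2).tendsto 0
    simpa using this.mono_left nhdsWithin_le_nhds
  refine mem_closure_of_tendsto hlim ?_
  filter_upwards [eventually_mem_nhdsWithin] with s hs
  have h1 : 0 ≤ x 2 := hx
  have h2 : 0 < s := hs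
  simp only [openHalf, mem_ofPred_eq, PiLp.add_apply, PiLp.smul_apply, e_apply, smul_eq_mul]
  simp
  linarith

lemma uniqueDiffOn_closedHalf : UniqueDiffOn ℝ closedHalf := by
  rw [← closure_openHalf]
  refine uniqueDiffOn_convex convex_openHalf.closure ⟨e 2, ?_⟩
  refine interior_mono subset_closure ?_
  rw [isOpen_openHalf.interior_eq]
  simp [openHalf, e_apply]

lemma closedHalf_mem_nhds {x : E3} (hx : x ∈ openHalf) : closedHalf ∈ 𝓝 x :=
  mem_of_superset (isOpen_openHalf.mem_nhds hx) openHalf_subset_closedHalf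

/-- Reflection in the boundary plane. -/
def refl : E3 ≃ₗᵢ[ℝ] E3 :=
  LinearIsometryEquiv.piLpCongrRight 2 fun i : Fin 3 =>
    if i = 2 then LinearIsometryEquiv.neg ℝ else LinearIsometryEquiv.refl ℝ ℝ

lemma refl_apply (x : E3) (i : Fin 3) : refl x i = if i = 2 then -x i else x i := by
  simp only [refl, LinearIsometryEquiv.piLpCongrRight_apply]
  split_ifs <;> rfl

lemma refl_refl (x : E3) : refl (refl x) = x := by
  ext i
  simp only [refl_apply]
  split_ifs <;> simp

lemma refl_e {i : Fin 3} (hi : i ≠ 2) : refl (e i) = e i := by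
  ext j
  simp only [refl_apply, e_apply]
  split_ifs <;> simp_all

lemma refl_of_eq_zero {x : E3} (hx : x 2 = 0) : refl x = x := by
  ext j
  rw [refl_apply]
  split_ifs with h
  · rw [h, hx, neg_zero]
  · rfl

/-- The odd extension of a function from the half-space to the whole space. -/
def oddExt (g : E3 → ℝ) (x : E3) : ℝ := openHalf.indicator g x - openHalf.indicator g (refl x)

lemma oddExt_refl (g : E3 → ℝ) (x : E3) : oddExt g (refl x) = -oddExt g x := by
  simp [oddExt, refl_refl]

lemma refl_notMem_openHalf {x : E3} (hx : x ∈ openHalf) : refl x ∉ openHalf := by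
  simp only [openHalf, mem_ofPred_eq, refl_apply] at *
  simp
  exact hx.le

lemma oddExt_of_mem (g : E3 → ℝ) {x : E3} (hx : x ∈ openHalf) : oddExt g x = g x := by
  rw [oddExt, indicator_of_mem hx, indicator_of_notMem (refl_notMem_openHalf hx), sub_zero]

lemma abs_oddExt_le {g : E3 → ℝ} {x : E3} {b : ℝ} (hb : 0 ≤ b)
    (h : ∀ z ∈ closedHalf, ‖z‖ = ‖x‖ → |g z| ≤ b) : |oddExt g x| ≤ b := by
  by_cases hx : x ∈ openHalf
  · rw [oddExt_of_mem g hx]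
    exact h x (openHalf_subset_closedHalf hx) rfl
  · rw [oddExt, indicator_of_notMem hx, zero_sub, abs_neg]
    by_cases hx' : refl x ∈ openHalf
    · rw [indicator_of_mem hx']
      exact h _ (openHalf_subset_closedHalf hx') (refl.norm_map x)
    · rw [indicator_of_notMem hx', abs_zero]
      exact hb

lemma aestronglyMeasurable_oddExt {g : E3 → ℝ} (hg : ContinuousOn g closedHalf) :
    AEStronglyMeasurable (oddExt g) := by
  have h1 : AEStronglyMeasurable (openHalf.indicator g) :=
    (aestronglyMeasurable_indicator_iff isOpen_openHalf.measurableSet).2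
      ((hg.mono openHalf_subset_closedHalf).aestronglyMeasurable isOpen_openHalf.measurableSet)
  exact h1.sub (h1.comp_measurePreserving refl.measurePreserving)

lemma contDiffOn_oddExt {g : E3 → ℝ} (hg : ContDiffOn ℝ ∞ g closedHalf) :
    ContDiffOn ℝ ∞ (oddExt g) openHalf :=
  (hg.mono openHalf_subset_closedHalf).congr fun _ hx => oddExt_of_mem g hx

/-- The reflection preserves volume and, being a linear isometry, leaves the radial kernel
unchanged; only the sign of the density changes. -/
lemma conv_ker_oddExt_refl (k : ℝ) (g : E3 → ℝ) (x : E3) :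
    conv (ker k) (oddExt g) (refl x) = -conv (ker k) (oddExt g) x := by
  unfold conv
  rw [← refl.measurePreserving.integral_comp refl.toHomeomorph.measurableEmbedding,
    ← integral_neg]
  refine integral_congr_ae (Eventually.of_forall fun z => ?_)
  simp only
  rw [oddExt_refl, ← map_sub, ker, ker, refl.norm_map]
  ring

lemma conv_ker_oddExt_boundary (k : ℝ) (g : E3 → ℝ) {x : E3} (hx : x 2 = 0) :
    conv (ker k) (oddExt g) x = 0 := by
  have h := conv_ker_oddExt_refl k g x
  rw [refl_of_eq_zero hx] at h
  linarith

/-! ### Smoothness up to the boundary for compactly supported data -/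

/-- Functions that are smooth up to the boundary and have bounded support. -/
structure HalfTest (g : E3 → ℝ) : Prop where
  smooth : ContDiffOn ℝ ∞ g closedHalf
  support : ∃ R, ∀ x ∈ closedHalf, R ≤ ‖x‖ → g x = 0

/-- Partial derivatives up to the boundary. -/
def hpd (i : Fin 3) (g : E3 → ℝ) (x : E3) : ℝ := fderivWithin ℝ g closedHalf x (e i)

lemma HalfTest.hpd {g : E3 → ℝ} (hg : HalfTest g) (i : Fin 3) : HalfTest (hpd i g) := by
  refine ⟨(hg.smooth.fderivWithin uniqueDiffOn_closedHalf (m := ∞) (by simp)).clm_apply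
    contDiffOn_const, ?_⟩
  obtain ⟨R, hR⟩ := hg.support
  -- The extra unit makes `g` vanish on a whole relative neighbourhood of `x`.
  refine ⟨R + 1, fun x hx hxR => ?_⟩
  have hev : g =ᶠ[𝓝[closedHalf] x] fun _ => 0 := by
    have : ∀ᶠ z in 𝓝[closedHalf] x, R < ‖z‖ :=
      nhdsWithin_le_nhds (continuous_norm.continuousAt.eventually (lt_mem_nhds (by linarith)))
    filter_upwards [this, self_mem_nhdsWithin] with z hz hzm
    exact hR z hzm hz.le
  unfold HalfSpace.hpd
  rw [hev.fderivWithin_eq (hR x hx (by linarith))]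
  simp

lemma HalfTest.exists_bound {g : E3 → ℝ} (hg : HalfTest g) :
    ∃ M R, 0 ≤ M ∧ (∀ x ∈ closedHalf, |g x| ≤ M) ∧ (∀ x, |oddExt g x| ≤ M) ∧
      ∀ x, R < ‖x‖ → oddExt g x = 0 := by
  obtain ⟨R, hR⟩ := hg.support
  obtain ⟨M, hM⟩ := ((isCompact_closedBall (0 : E3) R).inter_right
    isClosed_closedHalf).exists_bound_of_continuousOn
      (hg.smooth.continuousOn.mono inter_subset_right)
  have hM' : ∀ x ∈ closedHalf, |g x| ≤ max M 0 := by
    intro x hx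
    by_cases hxR : ‖x‖ ≤ R
    · exact (hM x ⟨by simpa using hxR, hx⟩).trans (le_max_left _ _)
    · rw [hR x hx (not_le.1 hxR).le, abs_zero]
      exact le_max_right _ _
  refine ⟨max M 0, R, le_max_right _ _, hM', fun x => abs_oddExt_le (le_max_right _ _)
    fun z hz _ => hM' z hz, fun x hx => ?_⟩
  have : |oddExt g x| ≤ 0 := abs_oddExt_le le_rfl fun z hz hzx => by
    rw [hR z hz (by linarith), abs_zero]
  exact abs_nonpos_iff.1 this

lemma HalfTest.admissible {g : E3 → ℝ} (hg : HalfTest g) : Admissible (oddExt g) := by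
  obtain ⟨M, R, -, -, hM, hR⟩ := hg.exists_bound
  refine ⟨?_, M, hM⟩
  rw [← integrableOn_iff_integrable_of_support_subset (s := closedBall 0 R)]
  · exact Measure.integrableOn_of_bounded measure_closedBall_lt_top.ne
      (aestronglyMeasurable_oddExt hg.smooth.continuousOn) (M := M) (Eventually.of_forall hM)
  · intro x hx
    by_contra h
    exact hx (hR x (by simpa using h))

lemma mem_openHalf_add {i : Fin 3} (hi : i ≠ 2) (w : E3) (s : ℝ) :
    w + s • e i ∈ openHalf ↔ w ∈ openHalf := by
  simp [openHalf, e_apply, hi.symm]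

/-- Tangential translations never cross the boundary plane, so the jump of the odd extension is not
seen. -/
lemma hasDerivAt_oddExt {g : E3 → ℝ} (hg : ContDiffOn ℝ ∞ g closedHalf) {i : Fin 3} (hi : i ≠ 2)
    (w : E3) (s : ℝ) :
    HasDerivAt (fun s : ℝ => oddExt g (w + s • e i)) (oddExt (hpd i g) (w + s • e i)) s := by
  have key : ∀ w : E3, HasDerivAt (fun s : ℝ => openHalf.indicator g (w + s • e i))
      (openHalf.indicator (hpd i g) (w + s • e i)) s := by
    intro w
    by_cases hw : w ∈ openHalf
    · have hm : ∀ s : ℝ, w + s • e i ∈ openHalf := fun s => (mem_openHalf_add hi w s).2 hw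
      simp only [indicator_of_mem (hm _)]
      have hd : HasFDerivAt g (fderivWithin ℝ g closedHalf (w + s • e i)) (w + s • e i) :=
        ((hg.differentiableOn (by simp) _ (openHalf_subset_closedHalf (hm s))).hasFDerivWithinAt
          ).hasFDerivAt (closedHalf_mem_nhds (hm s))
      have hl : HasDerivAt (fun s : ℝ => w + s • e i) (e i) s := by
        simpa using ((hasDerivAt_id s).smul_const (e i)).const_add w
      exact hd.comp_hasDerivAt s hl
    · have hm : ∀ s : ℝ, w + s • e i ∉ openHalf := fun s => by rwa [mem_openHalf_add hi w s]
      simp only [indicator_of_notMem (hm _)]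
      exact hasDerivAt_const s 0
  have h2 := key (refl w)
  have hr : ∀ s : ℝ, refl (w + s • e i) = refl w + s • e i := fun s => by
    rw [map_add, map_smul, refl_e hi]
  unfold oddExt
  simp only [hr]
  exact (key w).sub h2

/-- Tangential derivatives of the potential are potentials of tangential derivatives. -/
lemma HalfTest.hasDerivAt_conv {k : ℝ} (hk : 0 ≤ k) {g : E3 → ℝ} (hg : HalfTest g) {i : Fin 3}
    (hi : i ≠ 2) (x : E3) :
    HasDerivAt (fun s : ℝ => conv (ker k) (oddExt g) (x + s • e i))
      (conv (ker k) (oddExt (HalfSpace.hpd i g)) x) 0 := by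
  obtain ⟨M, R, hM0, -, hM, hR⟩ := (hg.hpd i).exists_bound
  have hmeas : ∀ {g : E3 → ℝ}, HalfTest g → ∀ y : E3,
      AEStronglyMeasurable fun t => ker k t * oddExt g (y - t) := by
    intro g hg y
    refine (measurable_ker k).aestronglyMeasurable.mul ?_
    exact (hg.admissible.integrable.comp_sub_left y).aestronglyMeasurable
  have hint : Integrable fun t => ker k t * oddExt g (x - t) := by
    have := (integrable_ker_mul hk hg.admissible x).comp_sub_left x
    simpa using this
  -- For `|s| < 1` the differentiated density is supported in this ball, and there the locally
  -- integrable kernel times the sup bound dominates.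
  have hb : Integrable ((closedBall x (R + 1)).indicator fun t => ‖ker k t‖ * M) := by
    rw [integrable_indicator_iff measurableSet_closedBall]
    exact ((locallyIntegrable_ker hk).integrableOn_isCompact
      (isCompact_closedBall x (R + 1))).norm.mul_const M
  have h := (hasDerivAt_integral_of_dominated_loc_of_deriv_le (μ := (volume : Measure E3))
    (F := fun (s : ℝ) t => ker k t * oddExt g (x + s • e i - t))
    (F' := fun (s : ℝ) t => ker k t * oddExt (HalfSpace.hpd i g) (x + s • e i - t))
    (x₀ := 0) (s := ball 0 1)
    (bound := (closedBall x (R + 1)).indicator fun t => ‖ker k t‖ * M)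
    (ball_mem_nhds 0 one_pos) (Eventually.of_forall fun s => hmeas hg _) (by simpa using hint)
    (hmeas (hg.hpd i) _) ?_ hb ?_).2
  · simp only [conv_eq_integral]
    simpa using h
  · refine Eventually.of_forall fun t s hs => ?_
    have hs' : |s| < 1 := by simpa using hs
    by_cases ht : t ∈ closedBall x (R + 1)
    · rw [indicator_of_mem ht, norm_mul]
      gcongr
      exact hM _
    · rw [indicator_of_notMem ht, hR, mul_zero, norm_zero]
      have h1 : R + 1 < ‖x - t‖ := by
        rw [norm_sub_rev]
        simpa [dist_eq_norm] using ht
      have h2 : ‖x - t‖ ≤ ‖x + s • e i - t‖ + ‖s • e i‖ := by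
        have := norm_sub_le (x + s • e i - t) (s • e i)
        rwa [show x + s • e i - t - s • e i = x - t by abel] at this
      rw [norm_smul, norm_e, mul_one, Real.norm_eq_abs] at h2
      linarith
  · refine Eventually.of_forall fun t s _ => ?_
    have h1 := (hasDerivAt_oddExt hg.smooth hi (x - t) s).const_mul (ker k t)
    have h2 : ∀ s : ℝ, x + s • e i - t = x - t + s • e i := fun s => by abel
    simp only [h2]
    exact h1

lemma HalfTest.interior {k : ℝ} (hk : 0 ≤ k) {g : E3 → ℝ} (hg : HalfTest g) {p : E3}
    (hp : p ∈ openHalf) :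
    ContDiffAt ℝ ∞ (conv (ker k) (oddExt g)) p ∧
      ∑ i, pd i (pd i (conv (ker k) (oddExt g))) p - k ^ 2 * conv (ker k) (oddExt g) p = g p := by
  have h := interior_regularity hk hg.admissible isOpen_openHalf (contDiffOn_oddExt hg.smooth) hp
  rwa [oddExt_of_mem g hp] at h

lemma HalfTest.pd_conv {k : ℝ} (hk : 0 ≤ k) {g : E3 → ℝ} (hg : HalfTest g) {i : Fin 3}
    (hi : i ≠ 2) {x : E3} (hx : x ∈ openHalf) :
    pd i (conv (ker k) (oddExt g)) x = conv (ker k) (oddExt (HalfSpace.hpd i g)) x := by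
  have hd : HasFDerivAt (conv (ker k) (oddExt g)) (fderiv ℝ (conv (ker k) (oddExt g)) x)
      (x + (0 : ℝ) • e i) := by
    rw [zero_smul, add_zero]
    exact ((hg.interior hk hx).1.differentiableAt (by simp)).hasFDerivAt
  have hl : HasDerivAt (fun s : ℝ => x + s • e i) (e i) 0 := by
    simpa using ((hasDerivAt_id (0 : ℝ)).smul_const (e i)).const_add x
  have h := hd.comp_hasDerivAt 0 hl
  exact h.unique (hg.hasDerivAt_conv hk hi x)

lemma pd_comm {f : E3 → ℝ} {x : E3} (hf : ContDiffAt ℝ ∞ f x) (i j : Fin 3) :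
    pd i (pd j f) x = pd j (pd i f) x := by
  have hd : DifferentiableAt ℝ (fderiv ℝ f) x :=
    (hf.fderiv_right (m := ∞) (by simp)).differentiableAt (by simp)
  have h : ∀ i j, pd i (pd j f) x = fderiv ℝ (fderiv ℝ f) x (e i) (e j) := by
    intro i j
    change fderiv ℝ (fun z => fderiv ℝ f z (e j)) x (e i) = _
    rw [fderiv_clm_apply hd (differentiableAt_const _)]
    simp
  rw [h, h]
  exact ((hf.of_le (m := (2 : ℕ∞)) (by exact_mod_cast le_top)).isSymmSndFDerivAt
    (by simp)).eq (e i) (e j)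

lemma abs_pd_le_of_lipschitz {f : E3 → ℝ} {C : NNReal} (hf : LipschitzWith C f) (i : Fin 3)
    (x : E3) : |pd i f x| ≤ C := by
  have := (fderiv ℝ f x).le_of_opNorm_le (norm_fderiv_le_of_lipschitz ℝ hf) (e i)
  rwa [norm_e, mul_one] at this

lemma exists_bound_conv_ker {k : ℝ} (hk : 0 ≤ k) {H : E3 → ℝ} (hH : Admissible H) :
    ∃ C, ∀ x, |conv (ker k) H x| ≤ C := by
  obtain ⟨C, hC⟩ := exists_integral_inv_norm_pow_mul_le (s := 1) (by norm_num) hH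
  have hN := normConst_pos
  refine ⟨normConst⁻¹ * C, fun x => ?_⟩
  refine (norm_integral_le_of_norm_le (f := fun z => ker k (x - z) * H z)
    ((integrable_inv_norm_pow_mul (s := 1) (by norm_num) hH x).const_mul normConst⁻¹) (Eventually.of_forall fun z => ?_)).trans ?_
  · rw [norm_mul, pow_one, ← mul_assoc]
    exact mul_le_mul_of_nonneg_right (abs_ker_le hk _) (abs_nonneg _)
  · rw [integral_const_mul]
    have := hC x
    gcongr

/-- Second normal derivative, expressed through the equation. -/
lemma HalfTest.pd_two_pd_two {k : ℝ} (hk : 0 ≤ k) {g : E3 → ℝ} (hg : HalfTest g) {x : E3}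
    (hx : x ∈ openHalf) :
    pd 2 (pd 2 (conv (ker k) (oddExt g))) x = g x + k ^ 2 * conv (ker k) (oddExt g) x -
      conv (ker k) (oddExt (HalfSpace.hpd 0 (HalfSpace.hpd 0 g))) x -
      conv (ker k) (oddExt (HalfSpace.hpd 1 (HalfSpace.hpd 1 g))) x := by
  have h := (hg.interior hk hx).2
  have ht : ∀ i : Fin 3, i ≠ 2 → pd i (pd i (conv (ker k) (oddExt g))) x =
      conv (ker k) (oddExt (HalfSpace.hpd i (HalfSpace.hpd i g))) x := by
    intro i hi
    have hev : pd i (conv (ker k) (oddExt g)) =ᶠ[𝓝 x]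
        conv (ker k) (oddExt (HalfSpace.hpd i g)) :=
      eventually_of_mem (isOpen_openHalf.mem_nhds hx) fun z hz => hg.pd_conv hk hi hz
    rw [(pd_congr hev i).eq_of_nhds, (hg.hpd i).pd_conv hk hi hx]
  rw [Fin.sum_univ_three, ht 0 (by decide), ht 1 (by decide)] at h
  linarith

lemma HalfTest.pd_pd_two {k : ℝ} (hk : 0 ≤ k) {g : E3 → ℝ} (hg : HalfTest g) {i : Fin 3}
    (hi : i ≠ 2) {x : E3} (hx : x ∈ openHalf) :
    pd i (pd 2 (conv (ker k) (oddExt g))) x =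
      pd 2 (conv (ker k) (oddExt (HalfSpace.hpd i g))) x := by
  rw [pd_comm (hg.interior hk hx).1]
  have hev : pd i (conv (ker k) (oddExt g)) =ᶠ[𝓝 x] conv (ker k) (oddExt (HalfSpace.hpd i g)) :=
    eventually_of_mem (isOpen_openHalf.mem_nhds hx) fun z hz => hg.pd_conv hk hi hz
  rw [(pd_congr hev 2).eq_of_nhds]

/-- The normal derivative of the potential extends continuously to the boundary. -/
lemma HalfTest.exists_continuous_pd_two {k : ℝ} (hk : 0 ≤ k) {g : E3 → ℝ} (hg : HalfTest g) :
    ∃ Q : E3 → ℝ, Continuous Q ∧ EqOn (pd 2 (conv (ker k) (oddExt g))) Q openHalf := by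
  set q := pd 2 (conv (ker k) (oddExt g)) with hq
  obtain ⟨C₀, h₀⟩ := exists_lipschitz_conv_ker hk (hg.hpd 0).admissible
  obtain ⟨C₁, h₁⟩ := exists_lipschitz_conv_ker hk (hg.hpd 1).admissible
  obtain ⟨B, -, -, hB, -⟩ := hg.exists_bound
  obtain ⟨B', hB'⟩ := exists_bound_conv_ker hk hg.admissible
  obtain ⟨B₀, hB₀⟩ := exists_bound_conv_ker hk ((hg.hpd 0).hpd 0).admissible
  obtain ⟨B₁, hB₁⟩ := exists_bound_conv_ker hk ((hg.hpd 1).hpd 1).admissible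
  set D : ℝ := C₀ + C₁ + (B + k ^ 2 * B' + B₀ + B₁) with hD
  have hcoord : ∀ (y : E3) (i : Fin 3), |y i| ≤ ‖y‖ := fun y i => PiLp.norm_apply_le y i
  -- The gradient of the normal derivative is bounded: its tangential components are normal
  -- derivatives of Lipschitz potentials, and its normal component is given by the equation. On a
  -- convex set this makes `q` Lipschitz, hence extendable.
  have hb : ∀ x ∈ openHalf, ‖fderiv ℝ q x‖ ≤ D.toNNReal := by
    intro x hx
    refine ContinuousLinearMap.opNorm_le_bound _ (NNReal.coe_nonneg _) fun y => ?_
    rw [fderiv_apply_eq_sum, Fin.sum_univ_three, hq, hg.pd_pd_two hk (by decide) hx,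
      hg.pd_pd_two hk (by decide) hx, hg.pd_two_pd_two hk hx]
    have e0 := abs_pd_le_of_lipschitz h₀ 2 x
    have e1 := abs_pd_le_of_lipschitz h₁ 2 x
    have e2 : |g x + k ^ 2 * conv (ker k) (oddExt g) x -
        conv (ker k) (oddExt (HalfSpace.hpd 0 (HalfSpace.hpd 0 g))) x -
        conv (ker k) (oddExt (HalfSpace.hpd 1 (HalfSpace.hpd 1 g))) x| ≤
        B + k ^ 2 * B' + B₀ + B₁ := by
      have i1 := hB x (openHalf_subset_closedHalf hx)
      have i2 : |k ^ 2 * conv (ker k) (oddExt g) x| ≤ k ^ 2 * B' := by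
        rw [abs_mul, abs_of_nonneg (sq_nonneg k)]
        exact mul_le_mul_of_nonneg_left (hB' x) (sq_nonneg k)
      refine (abs_sub _ _).trans (add_le_add ((abs_sub _ _).trans (add_le_add
        ((abs_add_le _ _).trans (add_le_add i1 i2)) (hB₀ x))) (hB₁ x))
    have hy := norm_nonneg y
    rw [Real.norm_eq_abs]
    calc _ ≤ ‖y‖ * C₀ + ‖y‖ * C₁ + ‖y‖ * (B + k ^ 2 * B' + B₀ + B₁) := by
          refine (abs_add_three _ _ _).trans ?_
          simp only [abs_mul]
          gcongr <;> exact hcoord _ _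
      _ = D * ‖y‖ := by rw [hD]; ring
      _ ≤ _ := by gcongr; exact Real.le_coe_toNNReal D
  have hlip : LipschitzOnWith D.toNNReal q openHalf :=
    convex_openHalf.lipschitzOnWith_of_nnnorm_fderiv_le
      (fun x hx => (contDiffAt_pd (hg.interior hk hx).1 2).differentiableAt (by simp)) hb
  obtain ⟨Q, hQ, hEq⟩ := hlip.extend_real
  exact ⟨Q, hQ.continuous, hEq⟩

/-- A function whose partial derivatives extend to `C^n` functions up to the boundary is `C^(n+1)`
up to the boundary. -/
lemma contDiffOn_succ_of_pd {w : E3 → ℝ} {p : Fin 3 → E3 → ℝ} {n : ℕ}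
    (hw : ContinuousOn w closedHalf) (hd : DifferentiableOn ℝ w openHalf)
    (hp : ∀ i, ContDiffOn ℝ n (p i) closedHalf)
    (heq : ∀ i, ∀ x ∈ openHalf, pd i w x = p i x) :
    ContDiffOn ℝ (n + 1 : ℕ) w closedHalf := by
  set D : E3 → E3 →L[ℝ] ℝ := fun x =>
    ∑ i, p i x • (EuclideanSpace.proj i : E3 →L[ℝ] ℝ) with hD
  have hDs : ContDiffOn ℝ n D closedHalf :=
    ContDiffOn.sum fun i _ => (hp i).smul contDiffOn_const
  have hfd : ∀ x ∈ openHalf, fderiv ℝ w x = D x := by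
    intro x hx
    ext y
    rw [fderiv_apply_eq_sum]
    simp [hD, heq _ x hx, mul_comm]
  rw [Nat.cast_succ, contDiffOn_succ_iff_hasFDerivWithinAt_of_uniqueDiffOn uniqueDiffOn_closedHalf]
  refine ⟨by simp, D, hDs, fun x hx => ?_⟩
  rw [← closure_openHalf]
  refine hasFDerivWithinAt_closure_of_tendsto_fderiv hd convex_openHalf isOpen_openHalf
    (fun y hy => ?_) ?_
  · rw [closure_openHalf] at hy
    exact (hw y hy).mono openHalf_subset_closedHalf
  · refine (((hDs.continuousOn x hx).mono openHalf_subset_closedHalf).tendsto).congr' ?_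
    filter_upwards [self_mem_nhdsWithin] with z hz
    exact (hfd z hz).symm

/-- Simultaneous induction on `n`, over all data `g`, for the potential and its extended normal
derivative `Q g`. The partial derivatives of each, up to the boundary, are functions of the same two
kinds for `g` or its tangential derivatives, plus `g` itself. -/
theorem HalfTest.contDiffOn_conv {k : ℝ} (hk : 0 ≤ k) {g : E3 → ℝ} (hg : HalfTest g) :
    ContDiffOn ℝ ∞ (conv (ker k) (oddExt g)) closedHalf := by
  have hQ : ∀ g : E3 → ℝ, ∃ Q : E3 → ℝ, HalfTest g →
      Continuous Q ∧ EqOn (pd 2 (conv (ker k) (oddExt g))) Q openHalf := by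
    intro g
    by_cases hg : HalfTest g
    · obtain ⟨Q, hQ⟩ := hg.exists_continuous_pd_two hk
      exact ⟨Q, fun _ => hQ⟩
    · exact ⟨0, fun h => absurd h hg⟩
  choose Q hQ using hQ
  suffices h : ∀ n : ℕ, ∀ g, HalfTest g → ContDiffOn ℝ n (conv (ker k) (oddExt g)) closedHalf ∧
      ContDiffOn ℝ n (Q g) closedHalf from contDiffOn_infty.2 fun n => (h n g hg).1
  have hcont : ∀ g, HalfTest g → Continuous (conv (ker k) (oddExt g)) := fun g hg => by
    obtain ⟨C, hC⟩ := exists_lipschitz_conv_ker hk hg.admissible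
    exact hC.continuous
  intro n
  induction n with
  | zero =>
    intro g hg
    simp only [Nat.cast_zero, contDiffOn_zero]
    exact ⟨(hcont g hg).continuousOn, (hQ g hg).1.continuousOn⟩
  | succ n ih =>
    intro g hg
    constructor
    · refine contDiffOn_succ_of_pd (p := ![conv (ker k) (oddExt (HalfSpace.hpd 0 g)),
        conv (ker k) (oddExt (HalfSpace.hpd 1 g)), Q g]) (hcont g hg).continuousOn
        (fun x hx => ((hg.interior hk hx).1.differentiableAt
          (by simp)).differentiableWithinAt) ?_ ?_
      · intro i
        fin_cases i
        · exact (ih _ (hg.hpd 0)).1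
        · exact (ih _ (hg.hpd 1)).1
        · exact (ih g hg).2
      · intro i x hx
        fin_cases i
        · exact hg.pd_conv hk (by decide) hx
        · exact hg.pd_conv hk (by decide) hx
        · exact (hQ g hg).2 hx
    · have hev : ∀ x ∈ openHalf, Q g =ᶠ[𝓝 x] pd 2 (conv (ker k) (oddExt g)) := fun x hx =>
        eventually_of_mem (isOpen_openHalf.mem_nhds hx) fun z hz => ((hQ g hg).2 hz).symm
      refine contDiffOn_succ_of_pd (p := ![Q (HalfSpace.hpd 0 g), Q (HalfSpace.hpd 1 g),
        fun x => g x + k ^ 2 * conv (ker k) (oddExt g) x -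
          conv (ker k) (oddExt (HalfSpace.hpd 0 (HalfSpace.hpd 0 g))) x -
          conv (ker k) (oddExt (HalfSpace.hpd 1 (HalfSpace.hpd 1 g))) x])
        (hQ g hg).1.continuousOn (fun x hx => ?_) ?_ ?_
      · exact (((contDiffAt_pd (hg.interior hk hx).1 2).differentiableAt
          (by simp)).congr_of_eventuallyEq (hev x hx)).differentiableWithinAt
      · intro i
        fin_cases i
        · exact (ih _ (hg.hpd 0)).2
        · exact (ih _ (hg.hpd 1)).2
        · exact (((hg.smooth.of_le (by exact_mod_cast le_top)).add
            (contDiffOn_const.mul (ih g hg).1)).sub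
              (ih _ ((hg.hpd 0).hpd 0)).1).sub (ih _ ((hg.hpd 1).hpd 1)).1
      · intro i x hx
        rw [(pd_congr (hev x hx) i).eq_of_nhds]
        fin_cases i
        · exact (hg.pd_pd_two hk (by decide) hx).trans ((hQ _ (hg.hpd 0)).2 hx)
        · exact (hg.pd_pd_two hk (by decide) hx).trans ((hQ _ (hg.hpd 1)).2 hx)
        · exact hg.pd_two_pd_two hk hx

/-! ### The Dirichlet problem for decaying data -/

/-- Compactness covers a large ball; outside it `‖x‖ ≥ 1` gives `1 + ‖x‖ ≤ 2‖x‖`, whence the factor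
`2 ^ s`. -/
lemma exists_bound_of_decay {f : E3 → ℝ} {s : ℝ} (hs : 0 < s) (hf : ContinuousOn f closedHalf)
    (hd : DecaysAtInfinity f s) :
    ∃ C, 0 ≤ C ∧ ∀ x ∈ closedHalf, |f x| ≤ C * (1 + ‖x‖) ^ (-s) := by
  obtain ⟨C₀, R, hR, hC₀⟩ := hd
  obtain ⟨M, hM⟩ := ((isCompact_closedBall (0 : E3) (max R 1)).inter_right
    isClosed_closedHalf).exists_bound_of_continuousOn (hf.mono inter_subset_right)
  refine ⟨|C₀| * 2 ^ s + |M| * (1 + max R 1) ^ s, by positivity, fun x hx => ?_⟩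
  have hx1 : 0 < 1 + ‖x‖ := by positivity
  rw [add_mul]
  by_cases hxR : ‖x‖ ≤ max R 1
  · have h1 : |f x| ≤ |M| := (hM x ⟨by simpa using hxR, hx⟩).trans (le_abs_self M)
    have h2 : 1 ≤ (1 + max R 1) ^ s * (1 + ‖x‖) ^ (-s) := by
      rw [Real.rpow_neg hx1.le, ← div_eq_mul_inv, one_le_div (by positivity)]
      gcongr
    have h3 : 0 ≤ |C₀| * 2 ^ s * (1 + ‖x‖) ^ (-s) := by positivity
    calc |f x| ≤ |M| * 1 := by rw [mul_one]; exact h1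
      _ ≤ |M| * ((1 + max R 1) ^ s * (1 + ‖x‖) ^ (-s)) := by gcongr
      _ ≤ _ := by rw [← mul_assoc]; linarith
  · rw [not_le, max_lt_iff] at hxR
    have h1 : |f x| ≤ C₀ * ‖x‖ ^ (-s) := hC₀ x hx hxR.1.le
    have h2 : ‖x‖ ^ (-s) ≤ 2 ^ s * (1 + ‖x‖) ^ (-s) := by
      have h4 : ‖x‖ ^ (-s) ≤ ((1 + ‖x‖) / 2) ^ (-s) :=
        Real.rpow_le_rpow_of_nonpos (by positivity) (by linarith) (by linarith)
      refine h4.trans_eq ?_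
      rw [Real.div_rpow hx1.le zero_le_two, Real.rpow_neg zero_le_two, div_inv_eq_mul, mul_comm]
    have h3 : 0 ≤ |M| * (1 + max R 1) ^ s * (1 + ‖x‖) ^ (-s) := by positivity
    calc |f x| ≤ C₀ * ‖x‖ ^ (-s) := h1
      _ ≤ |C₀| * ‖x‖ ^ (-s) := by gcongr; exact le_abs_self _
      _ ≤ |C₀| * (2 ^ s * (1 + ‖x‖) ^ (-s)) := by gcongr
      _ ≤ _ := by rw [← mul_assoc]; linarith

lemma one_add_norm_rpow_le_one (z : E3) {p : ℝ} (hp : 0 ≤ p) : (1 + ‖z‖) ^ (-p) ≤ 1 :=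
  Real.rpow_le_one_of_one_le_of_nonpos (by linarith [norm_nonneg z]) (by linarith)

lemma integrable_one_add_norm_rpow {p : ℝ} (hp : 3 < p) :
    Integrable fun z : E3 => (1 + ‖z‖) ^ (-p) :=
  integrable_one_add_norm (by simpa using hp)

lemma admissible_of_le_rpow {H : E3 → ℝ} {p C : ℝ} (hp : 3 < p) (hC : 0 ≤ C)
    (hm : AEStronglyMeasurable H) (h : ∀ z, |H z| ≤ C * (1 + ‖z‖) ^ (-p)) : Admissible H := by
  refine ⟨((integrable_one_add_norm_rpow hp).const_mul C).mono' hm (Eventually.of_forall h), C,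
    fun z => (h z).trans ?_⟩
  exact mul_le_of_le_one_right hC (one_add_norm_rpow_le_one z (by linarith))

lemma admissible_one_add_norm_rpow {p : ℝ} (hp : 3 < p) :
    Admissible fun z : E3 => (1 + ‖z‖) ^ (-p) :=
  admissible_of_le_rpow hp zero_le_one (integrable_one_add_norm_rpow hp).aestronglyMeasurable
    fun z => by rw [abs_of_nonneg (by positivity), one_mul]

/-- The left side is at most `min(A, B) ^ (-p)`. This separates the kernel from the weight in the
convolution estimate below. -/
lemma inv_mul_rpow_le {A B p : ℝ} (hA : 1 ≤ A) (hB : 1 ≤ B) (hp : 1 ≤ p) :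
    A⁻¹ * B ^ (-(p - 1)) ≤ A ^ (-p) + B ^ (-p) := by
  have hA0 : 0 < A := by linarith
  have hB0 : 0 < B := by linarith
  have hsplit : ∀ {D : ℝ}, 0 < D → D ^ (-p) = D⁻¹ * D ^ (-(p - 1)) := by
    intro D hD
    rw [← Real.rpow_neg_one, ← Real.rpow_add hD]
    ring_nf
  rcases le_total A B with h | h
  · have h1 : B ^ (-(p - 1)) ≤ A ^ (-(p - 1)) :=
      Real.rpow_le_rpow_of_nonpos hA0 h (by linarith)
    have h2 : 0 ≤ B ^ (-p) := by positivity
    rw [hsplit hA0]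
    have := mul_le_mul_of_nonneg_left h1 (inv_nonneg.2 hA0.le)
    linarith
  · have h1 : A⁻¹ ≤ B⁻¹ := inv_anti₀ hB0 h
    have h2 : 0 ≤ A ^ (-p) := by positivity
    rw [hsplit hB0]
    have := mul_le_mul_of_nonneg_right h1 (Real.rpow_nonneg hB0.le (-(p - 1)))
    linarith

lemma inv_norm_mul_rpow_le {p : ℝ} (hp : 1 ≤ p) (w z : E3) :
    ‖w‖⁻¹ * (1 + ‖z‖) ^ (-(p - 1)) ≤ (ball (0 : E3) 1).indicator (fun w => ‖w‖⁻¹ ^ 1) w +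
      2 * ((1 + ‖w‖) ^ (-p) + (1 + ‖z‖) ^ (-p)) := by
  by_cases hw : w ∈ ball (0 : E3) 1
  · rw [indicator_of_mem hw, pow_one]
    have h1 := mul_le_mul_of_nonneg_left (one_add_norm_rpow_le_one z (sub_nonneg.2 hp))
      (inv_nonneg.2 (norm_nonneg w))
    have h2 : 0 ≤ (1 + ‖w‖) ^ (-p) + (1 + ‖z‖) ^ (-p) := by positivity
    linarith
  · have hw1 : 1 ≤ ‖w‖ := by simpa using hw
    rw [indicator_of_notMem hw, zero_add]
    have h1 : ‖w‖⁻¹ ≤ 2 * (1 + ‖w‖)⁻¹ := by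
      rw [← div_eq_mul_inv, inv_eq_one_div, div_le_div_iff₀ (by positivity) (by positivity)]
      linarith
    calc ‖w‖⁻¹ * (1 + ‖z‖) ^ (-(p - 1)) ≤ 2 * (1 + ‖w‖)⁻¹ * (1 + ‖z‖) ^ (-(p - 1)) := by gcongr
      _ = 2 * ((1 + ‖w‖)⁻¹ * (1 + ‖z‖) ^ (-(p - 1))) := by ring
      _ ≤ _ := by
        gcongr
        exact inv_mul_rpow_le (by linarith) (by linarith [norm_nonneg z]) hp

/-- The weight alone may fail to be integrable, since `p - 1` can be at most `3`; the missing power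
comes from the decay of the kernel. -/
lemma exists_integral_inv_norm_mul_rpow_le {p : ℝ} (hp : 3 < p) :
    ∃ C, ∀ x : E3, Integrable (fun z : E3 => ‖x - z‖⁻¹ * (1 + ‖z‖) ^ (-(p - 1))) ∧
      ∫ z : E3, ‖x - z‖⁻¹ * (1 + ‖z‖) ^ (-(p - 1)) ≤ C := by
  have hJ := integrable_indicator_inv_norm_pow (s := 1) (by norm_num)
  have hP := integrable_one_add_norm_rpow hp
  set J : E3 → ℝ := (ball (0 : E3) 1).indicator fun w => ‖w‖⁻¹ ^ 1
  set P : E3 → ℝ := fun z => (1 + ‖z‖) ^ (-p)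
  refine ⟨(∫ w, J w) + 2 * ((∫ w, P w) + ∫ w, P w), fun x => ?_⟩
  have hJx := hJ.comp_sub_left x
  have hPx := hP.comp_sub_left x
  have hPP : Integrable fun z => 2 * (P (x - z) + P z) := (hPx.add hP).const_mul 2
  have hb : Integrable fun z => J (x - z) + 2 * (P (x - z) + P z) := hJx.add hPP
  have hle : ∀ z : E3, ‖x - z‖⁻¹ * (1 + ‖z‖) ^ (-(p - 1)) ≤ J (x - z) + 2 * (P (x - z) + P z) :=
    fun z => inv_norm_mul_rpow_le (by linarith) (x - z) z
  have hi : Integrable fun z : E3 => ‖x - z‖⁻¹ * (1 + ‖z‖) ^ (-(p - 1)) := by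
    refine hb.mono' (Measurable.aestronglyMeasurable (by fun_prop))
      (Eventually.of_forall fun z => ?_)
    rw [Real.norm_of_nonneg (by positivity)]
    exact hle z
  refine ⟨hi, (integral_mono hi hb hle).trans_eq ?_⟩
  rw [integral_add hJx hPP, integral_const_mul, integral_add hPx hP,
    integral_sub_left_eq_self J, integral_sub_left_eq_self P]

/-- Quadratic decay of the Newtonian potential of an odd density. -/
lemma exists_quadratic_decay {f : E3 → ℝ} {β C : ℝ} (hβ : 0 < β) (hC : 0 ≤ C)
    (hF : Admissible (oddExt f)) (hb : ∀ z, |oddExt f z| ≤ C * (1 + ‖z‖) ^ (-(4 + 2 * β))) :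
    ∃ D, ∀ x : E3, x ≠ 0 → |conv (ker 0) (oddExt f) x| ≤ D * (‖x‖ ^ 2)⁻¹ := by
  have hN := normConst_pos
  have hp : 3 < 3 + 2 * β := by linarith
  obtain ⟨B, hB⟩ := exists_integral_inv_norm_mul_rpow_le hp
  have hP := integrable_one_add_norm_rpow hp
  set F := oddExt f with hFd
  set P : E3 → ℝ := fun z => (1 + ‖z‖) ^ (-(3 + 2 * β)) with hPd
  set W : E3 → ℝ := fun z => (1 + ‖z‖) ^ (-(3 + 2 * β - 1)) with hWd
  refine ⟨2⁻¹ * (normConst⁻¹ * C * (8 * (∫ z, P z) + 4 * (B + B))), fun x hx => ?_⟩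
  have hx0 : 0 < ‖x‖ := norm_pos_iff.2 hx
  -- Averaging the potential at `x` with its negative at `refl x` brings in the kernel difference.
  have hodd : conv (ker 0) F x =
      2⁻¹ * ∫ z, (ker 0 (x - z) * F z - ker 0 (refl x - z) * F z) := by
    rw [integral_sub (integrable_ker_mul le_rfl hF x) (integrable_ker_mul le_rfl hF (refl x))]
    have := conv_ker_oddExt_refl 0 f x
    unfold conv at this ⊢
    rw [this]
    ring
  have hWi : ∀ y : E3, Integrable fun z => ‖y - z‖⁻¹ * W z := fun y => (hB y).1
  have hWW : Integrable fun z => 4 * (‖x - z‖⁻¹ * W z + ‖refl x - z‖⁻¹ * W z) :=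
    ((hWi x).add (hWi (refl x))).const_mul 4
  have hbi : Integrable fun z => normConst⁻¹ * C * (‖x‖ ^ 2)⁻¹ *
      (8 * P z + 4 * (‖x - z‖⁻¹ * W z + ‖refl x - z‖⁻¹ * W z)) :=
    ((hP.const_mul 8).add hWW).const_mul _
  have hmain : |∫ z, (ker 0 (x - z) * F z - ker 0 (refl x - z) * F z)| ≤
      ∫ z, normConst⁻¹ * C * (‖x‖ ^ 2)⁻¹ *
        (8 * P z + 4 * (‖x - z‖⁻¹ * W z + ‖refl x - z‖⁻¹ * W z)) := by
    refine norm_integral_le_of_norm_le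
      (f := fun z => ker 0 (x - z) * F z - ker 0 (refl x - z) * F z) hbi ?_
    filter_upwards [Measure.ae_ne volume x, Measure.ae_ne volume (refl x)] with z hz hz'
    rw [← sub_mul, norm_mul, Real.norm_eq_abs, Real.norm_eq_abs]
    set a := ‖x - z‖ with ha
    set b := ‖refl x - z‖ with hbd
    have ha0 : 0 < a := norm_pos_iff.2 (sub_ne_zero.2 hz.symm)
    have hb0 : 0 < b := norm_pos_iff.2 (sub_ne_zero.2 hz'.symm)
    have hz1 : 0 < 1 + ‖z‖ := by positivity
    have hP0 : 0 ≤ P z := by positivity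
    have hW0 : 0 ≤ W z := by positivity
    -- Near region: both distances are comparable to `‖x‖`, and the difference gains `‖z‖ / ‖x‖²`,
    -- leaving the integrable weight `P`. Far region: two powers of the decay of `F` yield `‖x‖⁻²`,
    -- leaving `W` against each kernel.
    by_cases hzx : ‖z‖ ≤ ‖x‖ / 2
    · have hax : ‖x‖ / 2 ≤ a := by
        have := norm_sub_norm_le x z
        linarith
      have hbx : ‖x‖ / 2 ≤ b := by
        have := norm_sub_norm_le (refl x) z
        rw [refl.norm_map] at this
        linarith
      -- By reflection `b = ‖x - refl z‖`, so `a` and `b` differ by at most `‖z - refl z‖`.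
      have hba : |b - a| ≤ 2 * ‖z‖ := by
        have h1 : b = ‖x - refl z‖ := by
          rw [hbd, ← refl.norm_map (x - refl z), map_sub, refl_refl]
        rw [h1, ha]
        refine (abs_norm_sub_norm_le _ _).trans ?_
        rw [sub_sub_sub_cancel_left]
        refine (norm_sub_le _ _).trans ?_
        rw [refl.norm_map]
        linarith
      have hker := abs_ker_sub_le le_rfl (sub_ne_zero.2 hz.symm) (sub_ne_zero.2 hz'.symm)
      have hab : a⁻¹ * b⁻¹ ≤ 4 * (‖x‖ ^ 2)⁻¹ := by
        have h1 : a⁻¹ ≤ (‖x‖ / 2)⁻¹ := inv_anti₀ (by positivity) hax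
        have h2 : b⁻¹ ≤ (‖x‖ / 2)⁻¹ := inv_anti₀ (by positivity) hbx
        calc a⁻¹ * b⁻¹ ≤ (‖x‖ / 2)⁻¹ * (‖x‖ / 2)⁻¹ := by gcongr
          _ = 4 * (‖x‖ ^ 2)⁻¹ := by field_simp; norm_num
      have hPz : ‖z‖ * (1 + ‖z‖) ^ (-(4 + 2 * β)) ≤ P z := by
        have : P z = (1 + ‖z‖) * (1 + ‖z‖) ^ (-(4 + 2 * β)) := by
          rw [hPd]
          simp only
          rw [← Real.rpow_one_add' hz1.le (by linarith)]
          ring_nf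
        rw [this]
        gcongr
        linarith
      calc |ker 0 (x - z) - ker 0 (refl x - z)| * |F z|
          ≤ (normConst⁻¹ * (2 * ‖z‖ * (4 * (‖x‖ ^ 2)⁻¹))) *
              (C * (1 + ‖z‖) ^ (-(4 + 2 * β))) := by
            refine mul_le_mul (hker.trans ?_) (hb z) (abs_nonneg _) (by positivity)
            gcongr
        _ = normConst⁻¹ * C * (‖x‖ ^ 2)⁻¹ * (8 * (‖z‖ * (1 + ‖z‖) ^ (-(4 + 2 * β)))) := by ring
        _ ≤ normConst⁻¹ * C * (‖x‖ ^ 2)⁻¹ * (8 * P z + 4 * (a⁻¹ * W z + b⁻¹ * W z)) := by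
            gcongr
            have : 0 ≤ 4 * (a⁻¹ * W z + b⁻¹ * W z) := by positivity
            linarith
    · rw [not_le] at hzx
      have hker : |ker 0 (x - z) - ker 0 (refl x - z)| ≤ normConst⁻¹ * (a⁻¹ + b⁻¹) := by
        refine (abs_sub _ _).trans ?_
        rw [mul_add]
        exact add_le_add (abs_ker_le le_rfl _) (abs_ker_le le_rfl _)
      have hWz : (1 + ‖z‖) ^ (-(4 + 2 * β)) ≤ 4 * (‖x‖ ^ 2)⁻¹ * W z := by
        have h1 : (1 + ‖z‖) ^ (-(4 + 2 * β)) = ((1 + ‖z‖) ^ 2)⁻¹ * W z := by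
          rw [hWd]
          simp only
          rw [← Real.rpow_natCast, ← Real.rpow_neg hz1.le, ← Real.rpow_add hz1]
          congr 1
          push_cast
          ring
        rw [h1]
        gcongr
        calc ((1 + ‖z‖) ^ 2)⁻¹ ≤ ((‖x‖ / 2) ^ 2)⁻¹ := by
              gcongr
              linarith
          _ = 4 * (‖x‖ ^ 2)⁻¹ := by field_simp; norm_num
      calc |ker 0 (x - z) - ker 0 (refl x - z)| * |F z|
          ≤ (normConst⁻¹ * (a⁻¹ + b⁻¹)) * (C * (4 * (‖x‖ ^ 2)⁻¹ * W z)) := by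
            refine mul_le_mul hker ((hb z).trans ?_) (abs_nonneg _) (by positivity)
            gcongr
        _ = normConst⁻¹ * C * (‖x‖ ^ 2)⁻¹ * (4 * (a⁻¹ * W z + b⁻¹ * W z)) := by ring
        _ ≤ _ := by
            gcongr
            linarith
  rw [hodd, abs_mul, abs_of_pos (by norm_num : (0 : ℝ) < 2⁻¹)]
  rw [integral_const_mul, integral_add (hP.const_mul 8) hWW,
    integral_const_mul, integral_const_mul, integral_add (hWi x) (hWi (refl x))] at hmain
  calc _ ≤ 2⁻¹ * (normConst⁻¹ * C * (‖x‖ ^ 2)⁻¹ * (8 * (∫ z, P z) + 4 * (B + B))) := by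
        refine mul_le_mul_of_nonneg_left (hmain.trans ?_) (by norm_num)
        gcongr
        · exact (hB x).2
        · exact (hB (refl x)).2
    _ = _ := by ring

lemma exists_exp_mul_rpow_le {k : ℝ} (hk : 0 < k) (s : ℝ) :
    ∃ C, 0 ≤ C ∧ ∀ r, 0 ≤ r → Real.exp (-k * r) * (1 + r) ^ s ≤ C := by
  obtain ⟨m, hm⟩ := exists_nat_ge s
  -- From the bound of `(k(1 + r))^m / m!` by `e^{k(1 + r)}`; the factor `e^k` pays for the shift
  -- from `r` to `1 + r`.
  refine ⟨Real.exp k * m.factorial / k ^ m, by positivity, fun r hr => ?_⟩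
  have h1 := Real.pow_div_factorial_le_exp (k * (1 + r)) (by positivity) m
  have h2 : (1 + r) ^ s ≤ (1 + r) ^ m := by
    rw [← Real.rpow_natCast]
    exact Real.rpow_le_rpow_of_exponent_le (by linarith) hm
  rw [div_le_iff₀ (by positivity), mul_pow] at h1
  rw [le_div_iff₀ (by positivity)]
  have h3 : Real.exp (-k * r) * Real.exp (k * (1 + r)) = Real.exp k := by
    rw [← Real.exp_add]
    ring_nf
  calc Real.exp (-k * r) * (1 + r) ^ s * k ^ m
      ≤ Real.exp (-k * r) * (1 + r) ^ m * k ^ m := by gcongr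
    _ = Real.exp (-k * r) * (k ^ m * (1 + r) ^ m) := by ring
    _ ≤ Real.exp (-k * r) * (Real.exp (k * (1 + r)) * m.factorial) := by gcongr
    _ = Real.exp k * m.factorial := by rw [← mul_assoc, h3]

/-- The screened potential decays as fast as its density. -/
lemma exists_screened_decay {k : ℝ} (hk : 0 < k) {H : E3 → ℝ} {s C : ℝ} (hs : 0 ≤ s) (hC : 0 ≤ C)
    (hb : ∀ z, |H z| ≤ C * (1 + ‖z‖) ^ (-s)) :
    ∃ D, 0 ≤ D ∧ ∀ x, |conv (ker k) H x| ≤ D * (1 + ‖x‖) ^ (-s) := by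
  have hN := normConst_pos
  -- The exponential absorbs `s` powers for transferring the weight from `z` to `x`, and four more
  -- so that what remains is integrable.
  obtain ⟨A, hA0, hA⟩ := exists_exp_mul_rpow_le hk (s + 4)
  have hi := integrable_inv_norm_pow_mul (s := 1) (by norm_num)
    (admissible_one_add_norm_rpow (p := 4) (by norm_num)) 0
  set I : E3 → ℝ := fun w => ‖w‖⁻¹ * (1 + ‖w‖) ^ (-(4 : ℝ)) with hI
  have hIi : Integrable I := by
    refine hi.congr (Eventually.of_forall fun w => ?_)
    simp only [zero_sub, norm_neg, pow_one, hI]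
    rw [abs_of_nonneg (by positivity)]
  have hI0 : 0 ≤ ∫ w, I w := integral_nonneg fun w => by positivity
  refine ⟨normConst⁻¹ * C * A * ∫ w, I w, by positivity, fun x => ?_⟩
  have hx1 : 0 < 1 + ‖x‖ := by positivity
  have hbi : Integrable fun z => normConst⁻¹ * C * A * (1 + ‖x‖) ^ (-s) * I (x - z) :=
    (hIi.comp_sub_left x).const_mul _
  refine (norm_integral_le_of_norm_le (f := fun z => ker k (x - z) * H z) hbi
    (Eventually.of_forall fun z => ?_)).trans_eq ?_
  · rw [norm_mul, Real.norm_eq_abs, Real.norm_eq_abs, abs_ker]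
    have hw1 : 0 < 1 + ‖x - z‖ := by positivity
    have hz1 : 0 < 1 + ‖z‖ := by positivity
    -- Peetre's inequality trades the weight at `z` for the weight at `x`, at the cost of a power of
    -- `1 + ‖x - z‖`.
    have hpeetre : 1 + ‖x‖ ≤ (1 + ‖x - z‖) * (1 + ‖z‖) := by
      have h1 : ‖x‖ ≤ ‖x - z‖ + ‖z‖ := by simpa using norm_add_le (x - z) z
      nlinarith [mul_nonneg (norm_nonneg (x - z)) (norm_nonneg z)]
    have h2 : (1 + ‖z‖) ^ (-s) ≤ (1 + ‖x - z‖) ^ s * (1 + ‖x‖) ^ (-s) := by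
      rw [Real.rpow_neg hz1.le, Real.rpow_neg hx1.le, ← div_eq_mul_inv, inv_eq_one_div,
        div_le_div_iff₀ (by positivity) (by positivity), one_mul, ← Real.mul_rpow hw1.le hz1.le]
      gcongr
    have h3 : Real.exp (-k * ‖x - z‖) * (1 + ‖x - z‖) ^ s ≤ A * (1 + ‖x - z‖) ^ (-(4 : ℝ)) := by
      have h4 := hA ‖x - z‖ (norm_nonneg _)
      rw [Real.rpow_neg hw1.le, ← div_eq_mul_inv, le_div_iff₀ (by positivity), mul_assoc,
        ← Real.rpow_add hw1]
      exact h4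
    calc normConst⁻¹ * (Real.exp (-k * ‖x - z‖) / ‖x - z‖) * |H z|
        ≤ normConst⁻¹ * (Real.exp (-k * ‖x - z‖) / ‖x - z‖) *
            (C * ((1 + ‖x - z‖) ^ s * (1 + ‖x‖) ^ (-s))) := by
          gcongr
          exact (hb z).trans (by gcongr)
      _ = normConst⁻¹ * C * (1 + ‖x‖) ^ (-s) * ‖x - z‖⁻¹ *
            (Real.exp (-k * ‖x - z‖) * (1 + ‖x - z‖) ^ s) := by ring
      _ ≤ normConst⁻¹ * C * (1 + ‖x‖) ^ (-s) * ‖x - z‖⁻¹ *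
            (A * (1 + ‖x - z‖) ^ (-(4 : ℝ))) := by gcongr
      _ = _ := by rw [hI]; ring
  · rw [integral_const_mul, integral_sub_left_eq_self I]
    ring

/-- A smooth cutoff, equal to `1` on the ball of radius `R`. -/
def cutoff (R : ℝ) (x : E3) : ℝ := Real.smoothTransition (R ^ 2 + 1 - ‖x‖ ^ 2)

lemma contDiff_cutoff (R : ℝ) : ContDiff ℝ ∞ (cutoff R) :=
  Real.smoothTransition.contDiff.comp (contDiff_const.sub (contDiff_norm_sq ℝ))

lemma cutoff_mul_oddExt (R : ℝ) (f : E3 → ℝ) :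
    (fun z => cutoff R z * oddExt f z) = oddExt fun z => cutoff R z * f z := by
  ext z
  have h : cutoff R (refl z) = cutoff R z := by simp [cutoff]
  simp only [oddExt, indicator]
  split_ifs <;> simp [h, mul_sub]

lemma halfTest_cutoff_mul (R : ℝ) {f : E3 → ℝ} (hf : ContDiffOn ℝ ∞ f closedHalf) :
    HalfTest fun z => cutoff R z * f z := by
  refine ⟨(contDiff_cutoff R).contDiffOn.mul hf, √(R ^ 2 + 1), fun x _ hxR => ?_⟩
  have h : R ^ 2 + 1 ≤ ‖x‖ ^ 2 := by
    rwa [Real.sqrt_le_left (norm_nonneg x)] at hxR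
  rw [cutoff, Real.smoothTransition.zero_of_nonpos (by linarith), zero_mul]

/-- Smoothness is local: a radial cutoff commutes with odd extension, so the near part is covered by
the compactly supported case, while the far part vanishes around `p`, even when `p` lies on the
boundary. -/
theorem contDiffOn_conv_ker_oddExt {k : ℝ} (hk : 0 ≤ k) {f : E3 → ℝ}
    (hf : ContDiffOn ℝ ∞ f closedHalf) (hF : Admissible (oddExt f)) :
    ContDiffOn ℝ ∞ (conv (ker k) (oddExt f)) closedHalf := by
  intro p hp
  set R := ‖p‖ + 1 with hR
  have hc := (contDiff_cutoff R).continuous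
  have h0 : ∀ x, 0 ≤ cutoff R x := fun x => Real.smoothTransition.nonneg _
  have h1 : ∀ x, cutoff R x ≤ 1 := fun x => Real.smoothTransition.le_one _
  rw [conv_ker_split hk hF hc h0 h1, cutoff_mul_oddExt]
  refine ((halfTest_cutoff_mul R hf).contDiffOn_conv hk p hp).add ?_
  refine (contDiffAt_conv_ker_of_eventually_zero hk ?_ ?_).1.contDiffWithinAt
  · have hc' : Continuous fun x => 1 - cutoff R x := continuous_const.sub hc
    refine (hF.mul_of_abs_le_one hc' fun x => ?_).integrable
    rw [abs_le]
    constructor <;> linarith [h0 x, h1 x]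
  · have hev : ∀ᶠ x in 𝓝 p, ‖x‖ < R :=
      continuous_norm.continuousAt.eventually (gt_mem_nhds (by linarith))
    filter_upwards [hev] with x hx
    have hsq : ‖x‖ ^ 2 ≤ R ^ 2 := by gcongr
    have : cutoff R x = 1 := Real.smoothTransition.one_of_one_le (by linarith)
    simp [this]

theorem isSmoothDirichletSolution_conv {k : ℝ} (hk : 0 ≤ k) {f : E3 → ℝ}
    (hf : ContDiffOn ℝ ∞ f closedHalf) (hF : Admissible (oddExt f)) :
    IsSmoothDirichletSolution (k ^ 2) f (conv (ker k) (oddExt f)) where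
  smooth := contDiffOn_conv_ker_oddExt hk hf hF
  equation := fun x hx => by
    obtain ⟨h1, h2⟩ := interior_regularity hk hF isOpen_openHalf (contDiffOn_oddExt hf) hx
    rw [oddExt_of_mem f hx] at h2
    rw [laplacian_eq_sum_pd (h1.of_le (m := (2 : ℕ∞)) (by exact_mod_cast le_top)), h2]
  boundary := fun x hx => conv_ker_oddExt_boundary k f hx

/-- The potential is Lipschitz and vanishes at the foot of the perpendicular from `x`, at distance
`x 2`. The estimate holds at every height, so `δ = 1` is arbitrary. -/
theorem vanishesLinearly_conv {k : ℝ} (hk : 0 ≤ k) {f : E3 → ℝ} (hF : Admissible (oddExt f)) :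
    VanishesLinearly (conv (ker k) (oddExt f)) := by
  obtain ⟨C, hC⟩ := exists_lipschitz_conv_ker hk hF
  refine ⟨C, 1, one_pos, fun x hx _ => ?_⟩
  have hx2 : 0 ≤ x 2 := hx
  have h0 := conv_ker_oddExt_boundary k f (x := x - x 2 • e 2) (by simp [e_apply])
  have h1 := hC.dist_le_mul x (x - x 2 • e 2)
  rw [h0, dist_zero_right, dist_eq_norm, sub_sub_cancel, norm_smul, norm_e, mul_one,
    Real.norm_of_nonneg hx2] at h1
  exact h1

end HalfSpace

end

theorem mainTheorem6 (β : ℝ) (hβ : 0 < β) (f : HalfSpace.E3 → ℝ)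
    (hf : ContDiffOn ℝ ∞ f HalfSpace.closedHalf)
    (hdecay : HalfSpace.DecaysAtInfinity f (4 + 2 * β)) :
    (∃ u : HalfSpace.E3 → ℝ,
      HalfSpace.IsSmoothDirichletSolution 0 f u ∧
      HalfSpace.VanishesLinearly u ∧
      HalfSpace.DecaysAtInfinity u 2) ∧
    (∀ t : ℝ, 0 < t → t ≤ 1 →
      ∃ u : HalfSpace.E3 → ℝ,
        HalfSpace.IsSmoothDirichletSolution t f u ∧
        HalfSpace.VanishesLinearly u ∧
        ∃ C : ℝ, ∀ β' : ℝ, β' < β → ∀ x ∈ HalfSpace.closedHalf,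
          |u x| ≤ C * HalfSpace.rhoHat x ^ (-(2 + 2 * β'))) := by
  open HalfSpace in
  obtain ⟨C, hC, hfC⟩ := exists_bound_of_decay (by linarith) hf.continuousOn hdecay
  have hb : ∀ z, |oddExt f z| ≤ C * (1 + ‖z‖) ^ (-(4 + 2 * β)) := fun z =>
    abs_oddExt_le (by positivity) fun w hw hwz => by rw [← hwz]; exact hfC w hw
  have hF : Admissible (oddExt f) :=
    admissible_of_le_rpow (by linarith) hC (aestronglyMeasurable_oddExt hf.continuousOn) hb
  refine ⟨⟨conv (ker 0) (oddExt f), ?_, vanishesLinearly_conv le_rfl hF, ?_⟩, fun t ht _ => ?_⟩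
  · simpa using isSmoothDirichletSolution_conv le_rfl hf hF
  · obtain ⟨D, hD⟩ := exists_quadratic_decay hβ hC hF hb
    refine ⟨D, 1, one_pos, fun x _ hx => ?_⟩
    have hx0 : 0 < ‖x‖ := lt_of_lt_of_le one_pos hx
    refine (hD x (norm_pos_iff.1 hx0)).trans_eq ?_
    rw [rho, Real.rpow_neg hx0.le, ← Real.rpow_natCast]
    norm_num
  · have hk : 0 < √t := Real.sqrt_pos.2 ht
    have hsol := isSmoothDirichletSolution_conv hk.le hf hF
    rw [Real.sq_sqrt ht.le] at hsol
    refine ⟨conv (ker √t) (oddExt f), hsol, vanishesLinearly_conv hk.le hF, ?_⟩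
    obtain ⟨D, hD0, hD⟩ := exists_screened_decay hk (by linarith) hC hb
    -- `D` belongs to the rate `4 + 2β` and is fixed before `β'`; since `1 ≤ rhoHat x ≤ 1 + ‖x‖`,
    -- lowering the exponent to `2 + 2β'` costs no constant.
    refine ⟨D, fun β' hβ' x _ => (hD x).trans ?_⟩
    have h1 : 1 ≤ rhoHat x := Real.one_le_sqrt.2 (by nlinarith [sq_nonneg (rho x)])
    have h2 : rhoHat x ≤ 1 + ‖x‖ :=
      Real.sqrt_le_iff.2 ⟨by positivity, by rw [rho]; nlinarith [norm_nonneg x]⟩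
    gcongr
    calc (1 + ‖x‖) ^ (-(4 + 2 * β)) ≤ rhoHat x ^ (-(4 + 2 * β)) :=
          Real.rpow_le_rpow_of_nonpos (by linarith) h2 (by linarith)
      _ ≤ rhoHat x ^ (-(2 + 2 * β')) := Real.rpow_le_rpow_of_exponent_le h1 (by linarith)
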